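/- Let $q$ and $a$ be indeterminates. Write $(x;q)_k=(1-x)(1-xq)\cdots(1-xq^{k-1})$ for the $q$-shifted factorial and $[m]_q=1+q+\cdots+q^{m-1}$ for the $q$-integer, with $[m]=[m]_q$. For rational functions $A,B$ in $q$ and $a$ and a polynomial $P\in\mathbb{Z}[q,a]$, the congruence $A\equiv B\pmod P$ means that $A-B=u/v$ for some polynomials $u,v\in\mathbb{Z}[q,a]$, $v\neq 0$, such that $P$ divides $u$ and $v$ is relatively prime to $P$ (i.e. has no non-unit common factor with $P$ in $\mathbb{Z}[q,a]$). Let $n>1$ be an odd integer, let $r\geqslant 1$ be an integer, and let $d\in\{1,2\}$. Then, modulo $$ [n^r]\prod_{j=0}^{(n^{r-1}-1)/d}(1-aq^{(2j+1)n})(a-q^{(2j+1)n}), $$ we have $$ \sum_{k=0}^{(n^r-1)/d} q^{k^2}[6k+1]\frac{(aq;q^2)_k (q/a;q^2)_k (q^2;q^4)_k }{(aq^4;q^4)_k(q^4/a;q^4)_k(q^4;q^4)_k} \equiv (-q)^{(1-n)/2} [n] \sum_{k=0}^{(n^{r-1}-1)/d} q^{nk^2}[6k+1]_{q^n}\frac{(aq^n;q^{2n})_k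 (q^n/a;q^{2n})_k (q^{2n};q^{4n})_k }{(aq^{4n};q^{4n})_k(q^{4n}/a;q^{4n})_k(q^{4n};q^{4n})_k}. $$ -/

import Mathlib

open Polynomial Finset

/-- The `q`-shifted factorial `(x; q)_k = (1 - x) (1 - x q) ⋯ (1 - x q^(k-1))`. -/
def qShifted {K : Type*} [CommRing K] (x q : K) (k : ℕ) : K :=
  ∏ i ∈ range k, (1 - x * q ^ i)

/-- The `q`-integer `[m]_q = 1 + q + ⋯ + q^(m-1)`. -/
def qInteger {K : Type*} [CommRing K] (q : K) (m : ℕ) : K :=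
  ∑ i ∈ range m, q ^ i

/-- The polynomial ring `ℤ[q][a]` in the two indeterminates `q` (inner) and `a` (outer). -/
abbrev PolyQA : Type := ℤ[X][X]

/-- The field of rational functions in `q` and `a`. -/
abbrev RatQA : Type := FractionRing PolyQA

/-- The indeterminate `q`, as a polynomial. -/
noncomputable def polyQ : PolyQA := C X

/-- The indeterminate `a`, as a polynomial. -/
noncomputable def polyA : PolyQA := X

/-- The indeterminate `q`, as a rational function. -/
noncomputable def ratQ : RatQA := algebraMap PolyQA RatQA polyQ

/-- The indeterminate `a`, as a rational function. -/
noncomputable def ratA : RatQA := algebraMap PolyQA RatQA polyA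

/-- `A ≡ B (mod P)` for rational functions `A`, `B` and a polynomial `P`: the difference `A - B`
is a fraction `u / v` of polynomials such that `P` divides `u` and `v` has no nonunit common
divisor with `P`. -/
def RatCongr (P : PolyQA) (A B : RatQA) : Prop :=
  ∃ u v : PolyQA, v ≠ 0 ∧ P ∣ u ∧ IsRelPrime v P ∧
    A - B = algebraMap PolyQA RatQA u / algebraMap PolyQA RatQA v

/-- The `a`-deformed sum
`∑_{k=0}^{M} q^(k^2) [6k+1]_q (aq;q^2)_k (q/a;q^2)_k (q^2;q^4)_k
  / ((aq^4;q^4)_k (q^4/a;q^4)_k (q^4;q^4)_k)`. -/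
def deformedSum {K : Type*} [Field K] (a q : K) (M : ℕ) : K :=
  ∑ k ∈ range (M + 1), q ^ (k ^ 2) * qInteger q (6 * k + 1) *
    (qShifted (a * q) (q ^ 2) k * qShifted (q / a) (q ^ 2) k * qShifted (q ^ 2) (q ^ 4) k /
      (qShifted (a * q ^ 4) (q ^ 4) k * qShifted (q ^ 4 / a) (q ^ 4) k *
        qShifted (q ^ 4) (q ^ 4) k))

/-! ### Shifted factorials and q-integers over a commutative ring. -/

section qShifted

variable {R : Type*} [CommRing R]

/-! The modulus is a product of pairwise coprime primes of ℤ[q,a]: the cyclotomic polynomials Φ_m(q)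
with m ∣ n^r, m ≠ 1, and the factors 1 - a q^N and a - q^N with N = (2j+1)n. Each prime generates
the kernel of an evaluation into a field (`IsKernelGenerator`), so it suffices that the difference
of the two sides is regular there and specializes to 0; `RatCongr.mul` and `RatCongr.prod` glue the
results.

At a = q^(±N) with q generic, both sums have a closed form, `deformedSum_inv_pow`: the sum at a =
q^(-(2j+1)) is [2j+1] / (-q)^j. It comes from a telescoping relation between the parameters u and
u/q^4, where u = 1/a. The two sides then agree because [n(2j+1)]_q = [n]_q [2j+1]_{q^n} and n is
odd.

At q = ζ of odd order m = 2M+1 > 1 with a generic, each side vanishes. Cleared of denominators, the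
sum up to M is a polynomial in a of degree at most 2M, and the closed form makes it vanish at all
2M+1 powers of ζ (`clearedSum_eq_zero`). Longer sums split into blocks of length m that are
multiples of the first, possibly ending with a half block (`sum_block_eq_zero`). On the right-hand
side either ζ^n = 1, so that [n] = 0, or the order of ζ^n divides n^(r-1) and the same argument
applies. -/

@[simp]
theorem qShifted_zero (x p : R) : qShifted x p 0 = 1 := by
  simp [qShifted]

theorem qShifted_succ (x p : R) (k : ℕ) :
    qShifted x p (k + 1) = qShifted x p k * (1 - x * p ^ k) := by
  simp [qShifted, prod_range_succ]

theorem qShifted_succ' (x p : R) (k : ℕ) :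
    qShifted x p (k + 1) = (1 - x) * qShifted (x * p) p k := by
  rw [qShifted, prod_range_succ', mul_comm]
  simp [qShifted, pow_succ', mul_assoc]

theorem qShifted_add (x p : R) (k l : ℕ) :
    qShifted x p (k + l) = qShifted x p k * qShifted (x * p ^ k) p l := by
  simp [qShifted, prod_range_add, pow_add, mul_assoc]

theorem qShifted_shift (x p : R) (k : ℕ) :
    (1 - x) * qShifted (x * p) p k = qShifted x p k * (1 - x * p ^ k) := by
  rw [← qShifted_succ', qShifted_succ]

theorem qShifted_ne_zero {K : Type*} [CommRing K] [IsDomain K] {x p : K} {k : ℕ}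
    (h : ∀ i < k, 1 - x * p ^ i ≠ 0) :
    qShifted x p k ≠ 0 :=
  prod_ne_zero_iff.mpr fun i hi => h i (mem_range.mp hi)

theorem qShifted_eq_zero {x p : R} {k i : ℕ} (hi : i < k) (h : x * p ^ i = 1) :
    qShifted x p k = 0 :=
  prod_eq_zero (mem_range.mpr hi) (by rw [h, sub_self])

theorem map_qShifted {S : Type*} [CommRing S] (f : R →+* S) (x p : R) (k : ℕ) :
    f (qShifted x p k) = qShifted (f x) (f p) k := by
  simp [qShifted]

theorem map_qInteger {S : Type*} [CommRing S] (f : R →+* S) (q : R) (m : ℕ) :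
    f (qInteger q m) = qInteger (f q) m := by
  simp [qInteger]

theorem qInteger_mul_one_sub (q : R) (m : ℕ) : qInteger q m * (1 - q) = 1 - q ^ m :=
  geom_sum_mul_neg q m

end qShifted

/-! ### Closed form at a = q^(-(2j+1)), by creative telescoping. -/

section ClosedForm

variable {K : Type*} [Field K]

theorem deformedSum_swap (a q : K) (M : ℕ) : deformedSum a⁻¹ q M = deformedSum a q M := by
  refine sum_congr rfl fun k _ => ?_
  rw [div_inv_eq_mul, div_inv_eq_mul, div_eq_mul_inv q a, div_eq_mul_inv (q ^ 4) a,
    mul_comm a⁻¹, mul_comm a⁻¹, mul_comm q a, mul_comm (q ^ 4) a]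
  ring

/-- The summand of `deformedSum u⁻¹ q`, multiplied by `1 - q`. -/
noncomputable def deformedTerm (u q : K) (k : ℕ) : K :=
  q ^ (k ^ 2) * (1 - q ^ (6 * k + 1)) *
    (qShifted (q / u) (q ^ 2) k * qShifted (q * u) (q ^ 2) k * qShifted (q ^ 2) (q ^ 4) k /
      (qShifted (q ^ 4 / u) (q ^ 4) k * qShifted (q ^ 4 * u) (q ^ 4) k *
        qShifted (q ^ 4) (q ^ 4) k))

theorem deformedSum_inv_mul_one_sub (u q : K) (M : ℕ) :
    deformedSum u⁻¹ q M * (1 - q) = ∑ k ∈ range (M + 1), deformedTerm u q k := by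
  rw [deformedSum, sum_mul]
  refine sum_congr rfl fun k _ => ?_
  rw [deformedTerm, ← qInteger_mul_one_sub, div_inv_eq_mul, div_inv_eq_mul, mul_comm u⁻¹,
    mul_comm u⁻¹, ← div_eq_mul_inv, ← div_eq_mul_inv]
  ring

/-- The antidifference certifying the contiguous relation between `deformedSum u⁻¹ q` and
`deformedSum (u / q ^ 4)⁻¹ q`. -/
noncomputable def deformedCert (u q : K) (k : ℕ) : K :=
  q ^ (k ^ 2) *
    (qShifted (q / u) (q ^ 2) k * qShifted (q * u) (q ^ 2) k * qShifted (q ^ 2) (q ^ 4) k /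
      (qShifted (q ^ 4 / u) (q ^ 4) k * qShifted (q ^ 4 * u) (q ^ 4) k *
        qShifted (q ^ 4) (q ^ 4) k)) *
    ((1 - q ^ (4 * k)) * (1 - u * q ^ (4 * k)) * (1 - u / q ^ 4) * (q ^ 2 + u) *
      (1 - q ^ (2 * k) / q) / ((1 - u * q ^ (2 * k) / q ^ 3) * (1 - u * q ^ (2 * k) / q)))

/-- This is the telescoping relation divided by the common hypergeometric factor at k, with x =
q^(2k); what remains is a rational identity in q, u, x. -/
theorem deformedCert_identity {q u x : K} (hq : q ≠ 0) (hu : u ≠ 0)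
    (h1 : u - q ^ 4 * x ^ 2 ≠ 0) (h2 : q - u * x ≠ 0) (h3 : q ^ 3 - u * x ≠ 0) :
    u ^ 2 / q ^ 4 * (1 - x * q / u) * (1 - x * q ^ 3 / u) * (1 - q ^ 4 / u) * (1 - u * x ^ 2) *
      (1 - q * x ^ 3) / ((1 - u * x / q ^ 3) * (1 - u * x / q) * (1 - q ^ 4 * x ^ 2 / u)) -
      q ^ 2 * (1 - u / q ^ 4) * (1 - q * x ^ 3) =
    q * x * (1 - x * q / u) * (1 - x ^ 2 * q ^ 2) *
        ((1 - u / q ^ 4) * (q ^ 2 + u) * (1 - q * x)) /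
        ((1 - q ^ 4 * x ^ 2 / u) * (1 - u * x / q)) -
      (1 - x ^ 2) * (1 - u * x ^ 2) * ((1 - u / q ^ 4) * (q ^ 2 + u) * (1 - x / q)) /
        ((1 - u * x / q ^ 3) * (1 - u * x / q)) := by
  have e1 : 1 - q ^ 4 * x ^ 2 / u = (u - q ^ 4 * x ^ 2) / u := by field_simp
  have e2 : 1 - u * x / q = (q - u * x) / q := by field_simp
  have e3 : 1 - u * x / q ^ 3 = (q ^ 3 - u * x) / q ^ 3 := by field_simp
  rw [e1, e2, e3]
  field_simp
  ring

/-- The factors b, d, f that the certificate shares with the shifted factorials cancel. All the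
others stay opaque, so nothing gets expanded. -/
theorem cert_quotient {b d f : K} (hb : b ≠ 0) (hd : d ≠ 0) (hf : f ≠ 0)
    (P y A a B E e C c D F w g : K) :
    P * y * (A * a * (B * b) * (E * e) / (C * c * (D * d) * (F * f))) * (f * d * w / (g * b)) =
      P * (A * B * E / (C * D * F)) * (y * a * e * w / (c * g)) := by
  have e1 : A * a * (B * b) * (E * e) / (C * c * (D * d) * (F * f)) =
      A * B * E / (C * D * F) * (a * b * e / (c * d * f)) := by
    rw [div_mul_div_comm]
    ring_nf
  have e2 : a * b * e / (c * d * f) * (f * d * w / (g * b)) = a * e * w / (c * g) := by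
    field_simp
  rw [e1]
  linear_combination P * y * (A * B * E / (C * D * F)) * e2

theorem term_quotient (P W A α B β E C γ D δ F : K) :
    P * W * (A * α * (B * β) * E / (C * γ * (D * δ) * F)) =
      P * (A * B * E / (C * D * F)) * (W * (α * β / (γ * δ))) := by
  have e1 : A * α * (B * β) * E / (C * γ * (D * δ) * F) =
      A * B * E / (C * D * F) * (α * β / (γ * δ)) := by
    rw [div_mul_div_comm]
    ring_nf
  rw [e1]
  ring

/-- Replacing u by u/q^4 moves the factorials of base q^2 by two steps and those of base q^4 by one,
so the new summand is a rational multiple of the old one. The factor 1 - u cancels a denominator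
created by the shift. -/
theorem deformedTerm_shift {q u : K} (hq : q ≠ 0) (hu : u ≠ 0)
    (h3 : ∀ i : ℕ, u * q ^ i ≠ q ^ 3) (h4 : ∀ i : ℕ, u ≠ q ^ 4 * (q ^ 4) ^ i) (k : ℕ) :
    (1 - u) * deformedTerm (u / q ^ 4) q k =
      q ^ (k ^ 2) *
        (qShifted (q / u) (q ^ 2) k * qShifted (q * u) (q ^ 2) k * qShifted (q ^ 2) (q ^ 4) k /
          (qShifted (q ^ 4 / u) (q ^ 4) k * qShifted (q ^ 4 * u) (q ^ 4) k *
            qShifted (q ^ 4) (q ^ 4) k)) *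
      (u ^ 2 / q ^ 4 * (1 - q ^ (2 * k) * q / u) * (1 - q ^ (2 * k) * q ^ 3 / u) *
        (1 - q ^ 4 / u) * (1 - u * (q ^ (2 * k)) ^ 2) * (1 - q * (q ^ (2 * k)) ^ 3) /
        ((1 - u * q ^ (2 * k) / q ^ 3) * (1 - u * q ^ (2 * k) / q) *
          (1 - q ^ 4 * (q ^ (2 * k)) ^ 2 / u))) := by
  have hx2 : (q ^ 2) ^ k = q ^ (2 * k) := by rw [← pow_mul]
  have hx4 : (q ^ 4) ^ k = (q ^ (2 * k)) ^ 2 := by rw [← pow_mul, ← pow_mul]; ring_nf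
  have hx6 : q ^ (6 * k + 1) = q * (q ^ (2 * k)) ^ 3 := by rw [← pow_mul]; ring_nf
  have n1 : u - q ≠ 0 := by
    intro h
    exact h3 2 (by rw [sub_eq_zero.mp h]; ring)
  have n3 : u - q ^ 3 ≠ 0 := by
    intro h
    exact h3 0 (by rw [sub_eq_zero.mp h]; ring)
  have n0 : 1 - u ≠ 0 := by
    intro h
    exact h3 3 (by rw [← sub_eq_zero.mp h]; ring)
  have n4 : u - q ^ 4 ≠ 0 := by
    intro h
    exact h4 0 (by rw [sub_eq_zero.mp h]; ring)
  have n5 : u - q ^ 4 * (q ^ (2 * k)) ^ 2 ≠ 0 := by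
    intro h
    exact h4 k (by rw [sub_eq_zero.mp h, hx4])
  have n6 : q - u * q ^ (2 * k) ≠ 0 := by
    intro h
    exact h3 (2 * k + 2) (by rw [pow_add, ← mul_assoc, ← sub_eq_zero.mp h]; ring)
  have n7 : q ^ 3 - u * q ^ (2 * k) ≠ 0 := by
    intro h
    exact h3 (2 * k) (by rw [← sub_eq_zero.mp h])
  have n8 : 1 - u * (q ^ (2 * k)) ^ 2 ≠ 0 := by
    intro h
    exact h3 (4 * k + 3) (by
      rw [pow_add, ← mul_assoc, show q ^ (4 * k) = (q ^ (2 * k)) ^ 2 by rw [← pow_mul]; ring_nf,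
        ← sub_eq_zero.mp h]; ring)
  have a1 := qShifted_shift (q / u) (q ^ 2) k
  have a2 := qShifted_shift (q / u * q ^ 2) (q ^ 2) k
  have b1 := qShifted_shift (u / q ^ 3) (q ^ 2) k
  have b2 := qShifted_shift (u / q ^ 3 * q ^ 2) (q ^ 2) k
  have c1 := qShifted_shift (q ^ 4 / u) (q ^ 4) k
  have d1 := qShifted_shift u (q ^ 4) k
  rw [show u / q ^ 3 * q ^ 2 * q ^ 2 = q * u by field_simp] at b2
  rw [mul_comm u (q ^ 4)] at d1
  rw [hx2] at a1 a2 b1 b2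
  rw [hx4] at c1 d1
  rw [deformedTerm, show q / (u / q ^ 4) = q / u * q ^ 2 * q ^ 2 by field_simp,
    show q * (u / q ^ 4) = u / q ^ 3 by field_simp,
    show q ^ 4 / (u / q ^ 4) = q ^ 4 / u * q ^ 4 by field_simp,
    show q ^ 4 * (u / q ^ 4) = u by field_simp, hx6]
  generalize q ^ (2 * k) = x at *
  have e1 : 1 - q / u = (u - q) / u := by field_simp
  have e2 : 1 - q / u * q ^ 2 = (u - q ^ 3) / u := by field_simp
  have e3 : 1 - u / q ^ 3 = -(u - q ^ 3) / q ^ 3 := by field_simp; ring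
  have e4 : 1 - u / q ^ 3 * q ^ 2 = -(u - q) / q := by field_simp; ring
  have e5 : 1 - q ^ 4 / u = (u - q ^ 4) / u := by field_simp
  have e6 : 1 - q ^ 4 / u * x ^ 2 = (u - q ^ 4 * x ^ 2) / u := by field_simp
  have e7 : 1 - u / q ^ 3 * x = (q ^ 3 - u * x) / q ^ 3 := by field_simp
  have e8 : 1 - u / q ^ 3 * q ^ 2 * x = (q - u * x) / q := by field_simp
  rw [e1] at a1
  rw [e2] at a2
  rw [e3, e7] at b1
  rw [e4, e8] at b2
  rw [e5, e6] at c1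
  generalize qShifted (q / u * q ^ 2 * q ^ 2) (q ^ 2) k = A₂ at *
  generalize qShifted (q / u * q ^ 2) (q ^ 2) k = A₁ at *
  generalize qShifted (q / u) (q ^ 2) k = A₀ at *
  generalize qShifted (u / q ^ 3 * q ^ 2) (q ^ 2) k = B₁ at *
  generalize qShifted (u / q ^ 3) (q ^ 2) k = B₀ at *
  generalize qShifted (q ^ 4 / u * q ^ 4) (q ^ 4) k = C₁ at *
  generalize qShifted (q ^ 4 / u) (q ^ 4) k = C₀ at *
  generalize qShifted (q ^ 4 * u) (q ^ 4) k = D₁ at *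
  generalize qShifted u (q ^ 4) k = D₀ at *
  generalize qShifted (q * u) (q ^ 2) k = B₂ at *
  generalize qShifted (q ^ 2) (q ^ 4) k = E₁ at *
  generalize qShifted (q ^ 4) (q ^ 4) k = E₂ at *
  have hA : A₂ = A₀ * ((1 - q / u * x) * (1 - q / u * q ^ 2 * x) * u ^ 2 /
      ((u - q) * (u - q ^ 3))) := by
    rw [← mul_div_assoc, eq_div_iff (mul_ne_zero n1 n3)]
    field_simp at a1 a2 ⊢
    linear_combination (u - q) * a2 + (u - q ^ 3 * x) * a1
  have hB : B₀ = B₂ * ((u - q) * (u - q ^ 3) / ((q ^ 3 - u * x) * (q - u * x))) := by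
    rw [← mul_div_assoc, eq_div_iff (mul_ne_zero n7 n6)]
    field_simp at b1 b2 ⊢
    linear_combination -(q - u * x) * b1 + (u - q ^ 3) * b2
  have hC : C₁ = C₀ * ((u - q ^ 4 * x ^ 2) / (u - q ^ 4)) := by
    rw [← mul_div_assoc, eq_div_iff n4]
    field_simp at c1 ⊢
    linear_combination c1
  have hD : D₀ = D₁ * ((1 - u) / (1 - u * x ^ 2)) := by
    rw [← mul_div_assoc, eq_div_iff n8, ← d1, mul_comm]
  have f1 : 1 - u * x / q ^ 3 = (q ^ 3 - u * x) / q ^ 3 := by field_simp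
  have f2 : 1 - u * x / q = (q - u * x) / q := by field_simp
  have f3 : 1 - q ^ 4 * x ^ 2 / u = (u - q ^ 4 * x ^ 2) / u := by field_simp
  rw [hA, hB, hC, hD, term_quotient, e5, f1, f2, f3, mul_left_comm]
  congr 1
  clear a1 a2 b1 b2 c1 d1 hA hB hC hD h3 h4 e1 e2 e3 e4 e5 e6 e7 e8 f1 f2 f3
  field_simp

theorem deformedCert_succ {q u : K} (hq : q ≠ 0) (hu : u ≠ 0) (h1 : ∀ i : ℕ, q ^ (i + 1) ≠ 1)
    (h3 : ∀ i : ℕ, u * q ^ i ≠ q ^ 3) (h4 : ∀ i : ℕ, u ≠ q ^ 4 * (q ^ 4) ^ i) (k : ℕ) :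
    deformedCert u q (k + 1) =
      q ^ (k ^ 2) *
        (qShifted (q / u) (q ^ 2) k * qShifted (q * u) (q ^ 2) k * qShifted (q ^ 2) (q ^ 4) k /
          (qShifted (q ^ 4 / u) (q ^ 4) k * qShifted (q ^ 4 * u) (q ^ 4) k *
            qShifted (q ^ 4) (q ^ 4) k)) *
      (q * q ^ (2 * k) * (1 - q ^ (2 * k) * q / u) * (1 - (q ^ (2 * k)) ^ 2 * q ^ 2) *
        ((1 - u / q ^ 4) * (q ^ 2 + u) * (1 - q * q ^ (2 * k))) /
        ((1 - q ^ 4 * (q ^ (2 * k)) ^ 2 / u) * (1 - u * q ^ (2 * k) / q))) := by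
  have hx2 : (q ^ 2) ^ k = q ^ (2 * k) := by rw [← pow_mul]
  have hx4 : (q ^ 4) ^ k = (q ^ (2 * k)) ^ 2 := by rw [← pow_mul, ← pow_mul]; ring_nf
  have n5 : u - q ^ 4 * (q ^ (2 * k)) ^ 2 ≠ 0 := by
    intro h
    exact h4 k (by rw [sub_eq_zero.mp h, hx4])
  have n6 : q - u * q ^ (2 * k) ≠ 0 := by
    intro h
    exact h3 (2 * k + 2) (by rw [pow_add, ← mul_assoc, ← sub_eq_zero.mp h]; ring)
  have n9 : 1 - u * q ^ (2 * k) * q ≠ 0 := by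
    intro h
    exact h3 (2 * k + 4) (by
      linear_combination -q ^ 3 * h)
  have n10 : 1 - u * (q ^ (2 * k)) ^ 2 * q ^ 4 ≠ 0 := by
    intro h
    exact h3 (4 * k + 7) (by
      rw [pow_add, show q ^ (4 * k) = (q ^ (2 * k)) ^ 2 by rw [← pow_mul]; ring_nf]
      linear_combination -q ^ 3 * h)
  have n11 : 1 - q ^ 4 * (q ^ (2 * k)) ^ 2 ≠ 0 := by
    intro h
    exact h1 (4 * k + 3) (by
      rw [show 4 * k + 3 + 1 = 4 + 2 * k * 2 by ring, pow_add, pow_mul]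
      linear_combination -h)
  rw [deformedCert]
  simp only [qShifted_succ, hx2, hx4]
  rw [show q ^ (2 * (k + 1)) = q ^ (2 * k) * q ^ 2 by ring,
    show q ^ (4 * (k + 1)) = (q ^ (2 * k)) ^ 2 * q ^ 4 by rw [← pow_mul]; ring,
    show q ^ ((k + 1) ^ 2) = q ^ (k ^ 2) * (q * q ^ (2 * k)) by ring]
  generalize q ^ (2 * k) = x at *
  generalize qShifted (q / u) (q ^ 2) k = A₀ at *
  generalize qShifted (q ^ 4 / u) (q ^ 4) k = C₀ at *
  generalize qShifted (q ^ 4 * u) (q ^ 4) k = D₁ at *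
  generalize qShifted (q * u) (q ^ 2) k = B₂ at *
  generalize qShifted (q ^ 2) (q ^ 4) k = E₁ at *
  generalize qShifted (q ^ 4) (q ^ 4) k = E₂ at *
  have f1 : 1 - u * (x * q ^ 2) / q ^ 3 = (q - u * x) / q := by field_simp
  have f2 : 1 - u * (x * q ^ 2) / q = 1 - u * x * q := by field_simp
  have f2' : 1 - u * x / q = (q - u * x) / q := by field_simp
  have f3 : 1 - q ^ 4 * x ^ 2 / u = (u - q ^ 4 * x ^ 2) / u := by field_simp
  have f4 : 1 - q ^ 4 / u * x ^ 2 = (u - q ^ 4 * x ^ 2) / u := by field_simp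
  have f5 : 1 - q ^ 4 * u * x ^ 2 = 1 - u * x ^ 2 * q ^ 4 := by ring
  have f6 : 1 - q * u * x = 1 - u * x * q := by ring
  have f7 : 1 - x ^ 2 * q ^ 4 = 1 - q ^ 4 * x ^ 2 := by ring
  have f8 : 1 - u * (x ^ 2 * q ^ 4) = 1 - u * x ^ 2 * q ^ 4 := by ring
  have f9 : 1 - x * q ^ 2 / q = 1 - q * x := by field_simp
  have f10 : 1 - q / u * x = 1 - x * q / u := by ring
  have f11 : 1 - q ^ 2 * x ^ 2 = 1 - x ^ 2 * q ^ 2 := by ring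
  rw [f1, f2, f2', f3, f4, f5, f6, f7, f8, f9, f10, f11]
  have h := cert_quotient n9 n10 n11 (q ^ k ^ 2) (q * x) A₀ (1 - x * q / u) B₂ E₁
    (1 - x ^ 2 * q ^ 2) C₀ ((u - q ^ 4 * x ^ 2) / u) D₁ E₂
    ((1 - u / q ^ 4) * (q ^ 2 + u) * (1 - q * x)) ((q - u * x) / q)
  rw [← h]
  ring

theorem deformedTerm_telescope {q u : K} (hq : q ≠ 0) (hu : u ≠ 0)
    (h1 : ∀ i : ℕ, q ^ (i + 1) ≠ 1)
    (h3 : ∀ i : ℕ, u * q ^ i ≠ q ^ 3) (h4 : ∀ i : ℕ, u ≠ q ^ 4 * (q ^ 4) ^ i) (k : ℕ) :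
    (1 - u) * deformedTerm (u / q ^ 4) q k - q ^ 2 * (1 - u / q ^ 4) * deformedTerm u q k =
      deformedCert u q (k + 1) - deformedCert u q k := by
  have hx4 : (q ^ 4) ^ k = (q ^ (2 * k)) ^ 2 := by rw [← pow_mul, ← pow_mul]; ring_nf
  have hx4' : q ^ (4 * k) = (q ^ (2 * k)) ^ 2 := by rw [← pow_mul]; ring_nf
  have hx6 : q ^ (6 * k + 1) = q * (q ^ (2 * k)) ^ 3 := by rw [← pow_mul]; ring_nf
  have n5 : u - q ^ 4 * (q ^ (2 * k)) ^ 2 ≠ 0 := by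
    intro h
    exact h4 k (by rw [sub_eq_zero.mp h, hx4])
  have n6 : q - u * q ^ (2 * k) ≠ 0 := by
    intro h
    exact h3 (2 * k + 2) (by rw [pow_add, ← mul_assoc, ← sub_eq_zero.mp h]; ring)
  have n7 : q ^ 3 - u * q ^ (2 * k) ≠ 0 := by
    intro h
    exact h3 (2 * k) (by rw [← sub_eq_zero.mp h])
  rw [deformedTerm_shift hq hu h3 h4, deformedCert_succ hq hu h1 h3 h4, deformedCert,
    deformedTerm, hx4', hx6]
  linear_combination q ^ (k ^ 2) *
    (qShifted (q / u) (q ^ 2) k * qShifted (q * u) (q ^ 2) k * qShifted (q ^ 2) (q ^ 4) k /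
      (qShifted (q ^ 4 / u) (q ^ 4) k * qShifted (q ^ 4 * u) (q ^ 4) k *
        qShifted (q ^ 4) (q ^ 4) k)) * deformedCert_identity hq hu n5 n6 n7

theorem sum_deformedTerm_telescope {q u : K} (hq : q ≠ 0) (hu : u ≠ 0)
    (h1 : ∀ i : ℕ, q ^ (i + 1) ≠ 1)
    (h3 : ∀ i : ℕ, u * q ^ i ≠ q ^ 3) (h4 : ∀ i : ℕ, u ≠ q ^ 4 * (q ^ 4) ^ i) (n : ℕ) :
    (1 - u) * ∑ k ∈ range n, deformedTerm (u / q ^ 4) q k -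
      q ^ 2 * (1 - u / q ^ 4) * ∑ k ∈ range n, deformedTerm u q k = deformedCert u q n := by
  rw [mul_sum, mul_sum, ← sum_sub_distrib,
    sum_congr rfl fun k _ => deformedTerm_telescope hq hu h1 h3 h4 k, sum_range_sub]
  -- The boundary term at 0 vanishes through its factor 1 - q^(4·0).
  simp [deformedCert]

/-- The sum `deformedSum` at `a = q ^ (-(2 j + 1))`. -/
theorem deformedSum_inv_pow {q : K} (hq : q ≠ 0) (h1 : ∀ i : ℕ, q ^ (i + 1) ≠ 1) (M j : ℕ)
    (hj : j ≤ M) :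
    (-q) ^ j * deformedSum (q ^ (2 * j + 1))⁻¹ q M = qInteger q (2 * j + 1) := by
  have hq1 : 1 - q ≠ 0 := fun h => h1 0 (by rw [zero_add, pow_one, ← sub_eq_zero.mp h])
  apply mul_right_cancel₀ hq1
  rw [qInteger_mul_one_sub, mul_assoc, deformedSum_inv_mul_one_sub]
  -- Dividing u = q^(2j+1) by q^4 lowers j by 2, so two base cases are needed; there (q/u; q^2)_k
  -- leaves only the terms k = 0, respectively k ≤ 1.
  induction j using Nat.strong_induction_on with
  | _ j ih =>
  match j, ih, hj with
  | 0, _, hj =>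
    rw [sum_range_succ', sum_eq_zero]
    · simp [deformedTerm]
    · intro k _
      rw [deformedTerm, qShifted_eq_zero (i := 0) (Nat.succ_pos k) (by field_simp; simp)]
      simp
  | 1, _, hj =>
    have hM : ∃ M', M + 1 = M' + 2 := ⟨M - 1, by omega⟩
    obtain ⟨M', hM'⟩ := hM
    rw [hM', sum_range_succ', sum_range_succ', sum_eq_zero]
    · have g4 : 1 - q ^ 4 ≠ 0 := fun h => h1 3 (by linear_combination -h)
      have g7 : 1 - q ^ 7 ≠ 0 := fun h => h1 6 (by linear_combination -h)
      simp [deformedTerm, qShifted]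
      have e1 : q ^ 4 / q ^ 3 = q := by field_simp
      have e2 : q / q ^ 3 = 1 / q ^ 2 := by field_simp
      rw [e1, e2, show q ^ 4 * q ^ 3 = q ^ 7 by ring]
      field_simp
      ring
    · intro k _
      rw [deformedTerm, qShifted_eq_zero (i := 1) (by omega) (by field_simp)]
      simp
  | j + 2, ih, hj =>
    have hN := ih j (by omega) (by omega)
    have key := sum_deformedTerm_telescope (q := q) (u := q ^ (2 * (j + 2) + 1)) hq
      (pow_ne_zero _ hq) h1 (fun i h => ?_) (fun i h => ?_) (M + 1)
    · have hu4 : q ^ (2 * (j + 2) + 1) / q ^ 4 = q ^ (2 * j + 1) := by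
        field_simp
        ring
      -- The sum terminates: for this u, (q/u; q^2)_(M+1) contains the zero factor of index j + 2 ≤
      -- M.
      have hcert : deformedCert (q ^ (2 * (j + 2) + 1)) q (M + 1) = 0 := by
        rw [deformedCert, qShifted_eq_zero (i := j + 2) (by omega)]
        · simp
        · field_simp
          ring
      rw [hu4, hcert] at key
      have n1 : 1 - q ^ (2 * j + 1) ≠ 0 := fun h => h1 (2 * j) (by linear_combination -h)
      apply mul_right_cancel₀ n1
      linear_combination (-1 : K) * (-q) ^ j * key + (1 - q ^ (2 * (j + 2) + 1)) * hN
    · refine h1 (2 * j + i + 1) (mul_right_cancel₀ (pow_ne_zero 3 hq) ?_)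
      linear_combination h
    -- The exponents have opposite parity, hence differ, and q is not a root of unity.
    · rcases lt_or_ge (2 * (j + 2) + 1) (4 + 4 * i) with hlt | hge
      · obtain ⟨c, hc⟩ := Nat.exists_eq_add_of_lt hlt
        refine h1 c (mul_left_cancel₀ (pow_ne_zero (2 * (j + 2) + 1) hq) ?_)
        rw [← pow_add, mul_one, h, show 2 * (j + 2) + 1 + (c + 1) = 4 + 4 * i by omega]
        ring
      · have hlt : 4 + 4 * i < 2 * (j + 2) + 1 := by omega
        obtain ⟨c, hc⟩ := Nat.exists_eq_add_of_lt hlt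
        refine h1 c (mul_left_cancel₀ (pow_ne_zero (4 + 4 * i) hq) ?_)
        rw [← pow_add, mul_one, show 4 + 4 * i + (c + 1) = 2 * (j + 2) + 1 by omega, h]
        ring

end ClosedForm

/-! ### Denominator-free sums and their vanishing at roots of unity. -/

section Cleared

variable {R : Type*} [CommRing R]

/-- The numerator of the ratio of consecutive `q`-shifted factorial quotients in `deformedSum`. -/
def ratioNum (a q : R) (i : ℕ) : R :=
  (1 - a * q ^ (2 * i + 1)) * (a - q ^ (2 * i + 1)) * (1 - q ^ (4 * i + 2))

/-- The denominator of the ratio of consecutive `q`-shifted factorial quotients in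
`deformedSum`. -/
def ratioDen (a q : R) (i : ℕ) : R :=
  (1 - a * q ^ (4 * i + 4)) * (a - q ^ (4 * i + 4)) * (1 - q ^ (4 * i + 4))

/-- The sum `deformedSum`, multiplied by a common denominator. -/
def clearedSum (a q : R) (M : ℕ) : R :=
  ∑ k ∈ range (M + 1), q ^ (k ^ 2) * qInteger q (6 * k + 1) *
    ((∏ i ∈ range k, ratioNum a q i) * ∏ i ∈ Ico k M, ratioDen a q i)

theorem map_ratioNum {S : Type*} [CommRing S] (f : R →+* S) (a q : R) (i : ℕ) :
    f (ratioNum a q i) = ratioNum (f a) (f q) i := by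
  simp [ratioNum]

theorem map_ratioDen {S : Type*} [CommRing S] (f : R →+* S) (a q : R) (i : ℕ) :
    f (ratioDen a q i) = ratioDen (f a) (f q) i := by
  simp [ratioDen]

theorem map_clearedSum {S : Type*} [CommRing S] (f : R →+* S) (a q : R) (M : ℕ) :
    f (clearedSum a q M) = clearedSum (f a) (f q) M := by
  simp [clearedSum, map_ratioNum, map_ratioDen, map_qInteger]

variable {K : Type*} [Field K]

theorem qShifted_quotient_eq_prod {a : K} (ha : a ≠ 0) (q : K) (k : ℕ) :
    qShifted (a * q) (q ^ 2) k * qShifted (q / a) (q ^ 2) k * qShifted (q ^ 2) (q ^ 4) k /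
      (qShifted (a * q ^ 4) (q ^ 4) k * qShifted (q ^ 4 / a) (q ^ 4) k *
        qShifted (q ^ 4) (q ^ 4) k) =
    ∏ i ∈ range k, ratioNum a q i / ratioDen a q i := by
  simp only [qShifted, ← prod_mul_distrib, ← prod_div_distrib]
  refine prod_congr rfl fun i _ => ?_
  rw [ratioNum, ratioDen]
  have e1 : 1 - q / a * (q ^ 2) ^ i = (a - q ^ (2 * i + 1)) / a := by
    field_simp
    ring
  have e2 : 1 - q ^ 4 / a * (q ^ 4) ^ i = (a - q ^ (4 * i + 4)) / a := by
    field_simp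
    ring
  rw [e1, e2]
  have e3 : 1 - a * q * (q ^ 2) ^ i = 1 - a * q ^ (2 * i + 1) := by ring
  have e4 : 1 - q ^ 2 * (q ^ 4) ^ i = 1 - q ^ (4 * i + 2) := by ring
  have e5 : 1 - a * q ^ 4 * (q ^ 4) ^ i = 1 - a * q ^ (4 * i + 4) := by ring
  have e6 : 1 - q ^ 4 * (q ^ 4) ^ i = 1 - q ^ (4 * i + 4) := by ring
  rw [e3, e4, e5, e6]
  field_simp

theorem clearedSum_eq_deformedSum_mul {a : K} (ha : a ≠ 0) (q : K) {M : ℕ}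
    (h : ∀ i < M, ratioDen a q i ≠ 0) :
    clearedSum a q M = deformedSum a q M * ∏ i ∈ range M, ratioDen a q i := by
  rw [clearedSum, deformedSum, sum_mul]
  refine sum_congr rfl fun k hk => ?_
  have hkM : k ≤ M := Nat.lt_succ_iff.mp (mem_range.mp hk)
  rw [qShifted_quotient_eq_prod ha, prod_div_distrib, ← prod_range_mul_prod_Ico _ hkM]
  have : ∏ i ∈ range k, ratioDen a q i ≠ 0 :=
    prod_ne_zero_iff.mpr fun i hi => h i ((mem_range.mp hi).trans_le hkM)
  field_simp

/-- Inverting a exchanges the two a-dependent factors of each `ratioNum` and `ratioDen` up to a^2,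
and every summand contains exactly M of these. -/
theorem clearedSum_inv {a : K} (ha : a ≠ 0) (q : K) (M : ℕ) :
    clearedSum a⁻¹ q M * (a ^ 2) ^ M = clearedSum a q M := by
  rw [clearedSum, clearedSum, sum_mul]
  refine sum_congr rfl fun k hk => ?_
  have hkM : k ≤ M := Nat.lt_succ_iff.mp (mem_range.mp hk)
  have e1 : ∀ i, ratioNum a q i = ratioNum a⁻¹ q i * a ^ 2 := fun i => by
    rw [ratioNum, ratioNum]
    field_simp
  have e2 : ∀ i, ratioDen a q i = ratioDen a⁻¹ q i * a ^ 2 := fun i => by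
    rw [ratioDen, ratioDen]
    field_simp
  simp only [e1, e2, prod_mul_distrib, prod_const, card_range, Nat.card_Ico]
  rw [← Nat.add_sub_cancel' hkM, pow_add, Nat.add_sub_cancel' hkM]
  ring

/-- Over ℤ[X] the variable is not a root of unity, so the closed form applies in the fraction field.
Being polynomial, the result can then be evaluated anywhere, including where `deformedSum` has
poles. -/
theorem clearedSum_pow_X (M j : ℕ) (hj : j ≤ M) :
    (-X) ^ j * clearedSum (X ^ (2 * j + 1)) X M =
      qInteger (X : ℤ[X]) (2 * j + 1) * ∏ i ∈ range M, ratioDen (X ^ (2 * j + 1)) X i := by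
  have hinj := IsFractionRing.injective ℤ[X] (FractionRing ℤ[X])
  apply hinj
  set q : FractionRing ℤ[X] := algebraMap ℤ[X] (FractionRing ℤ[X]) X with hqdef
  have hpow : ∀ {k l : ℕ}, q ^ k = q ^ l → k = l := fun {k l} h => by
    rw [hqdef, ← map_pow, ← map_pow] at h
    simpa using congrArg natDegree (hinj h)
  have hq : q ≠ 0 := fun h => by
    have := hpow (k := 1) (l := 2) (by rw [h]; simp)
    omega
  have ha : q ^ (2 * j + 1) ≠ 0 := pow_ne_zero _ hq
  have hden : ∀ i < M, ratioDen (q ^ (2 * j + 1)) q i ≠ 0 := fun i _ => by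
    refine mul_ne_zero (mul_ne_zero ?_ ?_) ?_ <;> refine sub_ne_zero.mpr fun h => ?_
    · have := hpow (k := 0) (l := 2 * j + 1 + (4 * i + 4)) (by rw [pow_add, ← h, pow_zero])
      omega
    · have := hpow h
      omega
    · have := hpow (k := 0) (l := 4 * i + 4) (by rw [pow_zero]; exact h)
      omega
  rw [map_mul, map_mul, map_clearedSum, map_prod, map_qInteger]
  simp only [map_ratioDen, map_pow, map_neg]
  rw [← hqdef, clearedSum_eq_deformedSum_mul ha q hden, ← mul_assoc, ← deformedSum_swap,
    deformedSum_inv_pow hq (fun i h => ?_) M j hj]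
  have := hpow (k := i + 1) (l := 0) (by rw [h, pow_zero])
  omega

theorem clearedSum_pow (z : R) (M j : ℕ) (hj : j ≤ M) :
    (-z) ^ j * clearedSum (z ^ (2 * j + 1)) z M =
      qInteger z (2 * j + 1) * ∏ i ∈ range M, ratioDen (z ^ (2 * j + 1)) z i := by
  have h := congrArg (eval₂RingHom (Int.castRingHom R) z) (clearedSum_pow_X M j hj)
  simp only [map_mul, map_prod, map_clearedSum, map_ratioDen, map_qInteger, map_pow,
    map_neg] at h
  simpa using h

theorem clearedSum_odd_pow_eq_zero {z : K} {M : ℕ} (hM : 1 ≤ M)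
    (hz : IsPrimitiveRoot z (2 * M + 1)) {j : ℕ} (hj : j ≤ M) :
    clearedSum (z ^ (2 * j + 1)) z M = 0 := by
  have hz0 : z ≠ 0 := hz.ne_zero (by omega)
  have h := clearedSum_pow z M j hj
  have hr : qInteger z (2 * j + 1) * ∏ i ∈ range M, ratioDen (z ^ (2 * j + 1)) z i = 0 := by
    rcases hj.eq_or_lt with rfl | hlt
    · rw [qInteger, hz.geom_sum_eq_zero (by omega), zero_mul]
    · rw [mul_eq_zero]
      right
      -- For j < M a factor of the denominator product vanishes. Solve 4i+4 ≡ ±(2j+1) mod 2M+1: for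
      -- M - j even, 2j+1 + (4i+4) = 2M+1; for M - j odd, 4i+4 = (2j+1) + (2M+1).
      rcases Nat.even_or_odd (M - j) with ⟨t, ht⟩ | ⟨t, ht⟩
      · refine prod_eq_zero (mem_range.mpr (show t - 1 < M by omega)) ?_
        rw [ratioDen, ← pow_add, show 2 * j + 1 + (4 * (t - 1) + 4) = 2 * M + 1 by omega,
          hz.pow_eq_one]
        simp
      · refine prod_eq_zero (mem_range.mpr (show (M + j - 1) / 2 < M by omega)) ?_
        rw [ratioDen, show 4 * ((M + j - 1) / 2) + 4 = (2 * j + 1) + (2 * M + 1) by omega,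
          pow_add z (2 * j + 1) (2 * M + 1), hz.pow_eq_one]
        simp
  rw [hr] at h
  exact (mul_eq_zero.mp h).resolve_left (pow_ne_zero _ (neg_ne_zero.mpr hz0))

/-- Since z has odd order, an even power of z is the inverse of an odd power, and `clearedSum_inv`
reduces to the odd case. -/
theorem clearedSum_root_eq_zero {z : K} {M : ℕ} (hM : 1 ≤ M)
    (hz : IsPrimitiveRoot z (2 * M + 1)) {e : ℕ} (he : e < 2 * M + 1) :
    clearedSum (z ^ e) z M = 0 := by
  have hz0 : z ≠ 0 := hz.ne_zero (by omega)
  rcases Nat.even_or_odd e with ⟨t, rfl⟩ | ⟨t, rfl⟩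
  · have h := clearedSum_odd_pow_eq_zero hM hz (j := M - t) (by omega)
    have e1 : z ^ (t + t) = (z ^ (2 * (M - t) + 1))⁻¹ := by
      rw [← mul_eq_one_iff_eq_inv₀ (pow_ne_zero _ hz0), ← pow_add,
        show t + t + (2 * (M - t) + 1) = 2 * M + 1 by omega, hz.pow_eq_one]
    have h2 := clearedSum_inv (pow_ne_zero (2 * (M - t) + 1) hz0) z M
    rw [h, ← e1] at h2
    exact (mul_eq_zero.mp h2).resolve_right
      (pow_ne_zero _ (pow_ne_zero _ (pow_ne_zero _ hz0)))
  · exact clearedSum_odd_pow_eq_zero hM hz (by omega)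

theorem natDegree_clearedSum_le (z : K) (M : ℕ) :
    (clearedSum (X : K[X]) (C z) M).natDegree ≤ 2 * M := by
  have hlin : ∀ c : K, (1 - X * C c : K[X]).natDegree ≤ 1 := fun c => by compute_degree
  have hlin' : ∀ c : K, (X - C c : K[X]).natDegree ≤ 1 := fun c => by compute_degree
  have hc : ∀ c : K, (1 - C c : K[X]).natDegree ≤ 0 := fun c => by compute_degree
  have hnum : ∀ i, (ratioNum (X : K[X]) (C z) i).natDegree ≤ 2 := fun i => by
    rw [ratioNum, ← C_pow, ← C_pow]
    exact natDegree_mul_le_of_le (natDegree_mul_le_of_le (hlin _) (hlin' _)) (hc _)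
  have hden : ∀ i, (ratioDen (X : K[X]) (C z) i).natDegree ≤ 2 := fun i => by
    rw [ratioDen, ← C_pow]
    exact natDegree_mul_le_of_le (natDegree_mul_le_of_le (hlin _) (hlin' _)) (hc _)
  refine natDegree_sum_le_of_forall_le _ _ fun k hk => ?_
  have hkM : k ≤ M := Nat.lt_succ_iff.mp (mem_range.mp hk)
  have h0 : (C z ^ k ^ 2 * qInteger (C z) (6 * k + 1)).natDegree ≤ 0 := by
    rw [← map_qInteger, ← C_pow, ← C_mul, natDegree_C]
  have h1 : (∏ i ∈ range k, ratioNum (X : K[X]) (C z) i).natDegree ≤ 2 * k := by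
    refine (natDegree_prod_le _ _).trans ((sum_le_sum fun i _ => hnum i).trans ?_)
    simp [mul_comm]
  have h2 : (∏ i ∈ Ico k M, ratioDen (X : K[X]) (C z) i).natDegree ≤ 2 * (M - k) := by
    refine (natDegree_prod_le _ _).trans ((sum_le_sum fun i _ => hden i).trans ?_)
    simp [mul_comm]
  refine (natDegree_mul_le_of_le h0 (natDegree_mul_le_of_le h1 h2)).trans ?_
  omega

/-- As a polynomial in the first argument, the sum has degree at most 2M but 2M+1 distinct zeros,
the powers of z. -/
theorem clearedSum_eq_zero {z : K} {M : ℕ} (hM : 1 ≤ M)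
    (hz : IsPrimitiveRoot z (2 * M + 1)) (x : K) : clearedSum x z M = 0 := by
  have heval : ∀ y : K, (clearedSum (X : K[X]) (C z) M).eval y = clearedSum y z M := fun y => by
    simpa using map_clearedSum (evalRingHom y) (X : K[X]) (C z) M
  have hp : clearedSum (X : K[X]) (C z) M = 0 := by
    refine eq_zero_of_natDegree_lt_card_of_eval_eq_zero _
      (f := fun e : Fin (2 * M + 1) => z ^ (e : ℕ)) ?_ ?_ ?_
    · intro e e' h
      exact Fin.ext (hz.pow_inj e.2 e'.2 h)
    · intro e
      rw [heval, clearedSum_root_eq_zero hM hz e.2]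
    · rw [Fintype.card_fin]
      exact Nat.lt_succ_of_le (natDegree_clearedSum_le z M)
  rw [← heval, hp, eval_zero]

theorem deformedSum_eq_zero_of_isPrimitiveRoot {z : K} {M : ℕ} (hM : 1 ≤ M)
    (hz : IsPrimitiveRoot z (2 * M + 1)) {x : K} (hx : x ≠ 0) (h1 : ∀ i : ℕ, x ≠ z ^ i)
    (h2 : ∀ i : ℕ, x * z ^ i ≠ 1) : deformedSum x z M = 0 := by
  have hden : ∀ i < M, ratioDen x z i ≠ 0 := fun i hi => by
    refine mul_ne_zero (mul_ne_zero ?_ ?_) ?_ <;> refine sub_ne_zero.mpr fun h => ?_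
    · exact h2 _ h.symm
    · exact h1 _ h
    · have hdvd : 2 * M + 1 ∣ 4 * (i + 1) := (hz.pow_eq_one_iff_dvd _).mp h.symm
      have hcop : Nat.Coprime (2 * M + 1) 4 :=
        Nat.Coprime.pow_right 2 (by simp : Nat.Coprime (2 * M + 1) 2)
      have := Nat.le_of_dvd (by omega) (hcop.dvd_of_dvd_mul_left hdvd)
      omega
  have h := clearedSum_eq_deformedSum_mul hx z hden
  rw [clearedSum_eq_zero hM hz] at h
  exact (mul_eq_zero.mp h.symm).resolve_right
    (prod_ne_zero_iff.mpr fun i hi => hden i (mem_range.mp hi))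

end Cleared

/-! ### Splitting longer sums into blocks at a root of unity. -/

section Blocks

variable {K : Type*} [Field K]

/-- The factor of the summand of `deformedSum` which has no poles at roots of unity `q` for
generic `a`. -/
noncomputable def deformedCoeff (a q : K) (k : ℕ) : K :=
  q ^ (k ^ 2) * qInteger q (6 * k + 1) *
    (qShifted (a * q) (q ^ 2) k * qShifted (q / a) (q ^ 2) k /
      (qShifted (a * q ^ 4) (q ^ 4) k * qShifted (q ^ 4 / a) (q ^ 4) k))

/-- The quotient `(q ^ 2; q ^ 4)_k / (q ^ 4; q ^ 4)_k`. -/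
noncomputable def centralCoeff (q : K) (k : ℕ) : K :=
  qShifted (q ^ 2) (q ^ 4) k / qShifted (q ^ 4) (q ^ 4) k

theorem deformedSum_eq_sum (a q : K) (M : ℕ) :
    deformedSum a q M = ∑ k ∈ range (M + 1), deformedCoeff a q k * centralCoeff q k := by
  refine sum_congr rfl fun k _ => ?_
  rw [deformedCoeff, centralCoeff, ← div_mul_div_comm]
  ring

/-- The powers of w run through all m-th roots of unity, so the product is the factorization of 1 -
y^m. -/
theorem qShifted_primitiveRoot {w : K} {m : ℕ} (hm : 0 < m) (hw : IsPrimitiveRoot w m) (y : K) :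
    qShifted y w m = 1 - y ^ m := by
  have h := hw.pow_sub_pow_eq_prod_sub_mul 1 y hm
  rw [one_pow] at h
  rw [h, qShifted]
  refine prod_nbij (fun i => w ^ i) ?_ ?_ ?_ ?_
  · intro i _
    rw [mem_nthRootsFinset hm, ← pow_mul, mul_comm, pow_mul, hw.pow_eq_one, one_pow]
  · intro i hi j hj h
    exact hw.pow_inj (by simpa using hi) (by simpa using hj) h
  · intro y hy
    obtain ⟨i, hi, rfl⟩ := (haveI : NeZero m := ⟨hm.ne'⟩; hw.eq_pow_of_pow_eq_one
      ((mem_nthRootsFinset hm _).mp hy))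
    exact ⟨i, by simpa using hi, rfl⟩
  · intro i _
    rw [mul_comm]

theorem qShifted_primitiveRoot_add {w : K} {m : ℕ} (hm : 0 < m) (hw : IsPrimitiveRoot w m)
    (y : K) (k : ℕ) : qShifted y w (m + k) = (1 - y ^ m) * qShifted y w k := by
  rw [qShifted_add, qShifted_primitiveRoot hm hw, hw.pow_eq_one, mul_one]

variable {z x : K} {M₀ : ℕ}

/-- The order is odd, so z^2 and z^4 are still primitive. A full period then multiplies numerator
and denominator by the same nonzero factor (1 - x^m)(1 - x^(-m)). -/
theorem deformedCoeff_add_period (hM : 1 ≤ M₀) (hz : IsPrimitiveRoot z (2 * M₀ + 1))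
    (hx : x ≠ 0) (h1 : ∀ i : ℕ, x ≠ z ^ i) (k : ℕ) :
    deformedCoeff x z (2 * M₀ + 1 + k) = deformedCoeff x z k := by
  have hm : 0 < 2 * M₀ + 1 := by omega
  have hz2 : IsPrimitiveRoot (z ^ 2) (2 * M₀ + 1) := hz.pow_of_coprime 2 (by simp)
  have hz4 : IsPrimitiveRoot (z ^ 4) (2 * M₀ + 1) :=
    hz.pow_of_coprime 4 (Nat.Coprime.pow_left 2 (by simp : Nat.Coprime 2 (2 * M₀ + 1)))
  have hz1 : 1 - z ≠ 0 := sub_ne_zero.mpr (hz.ne_one (by omega)).symm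
  have hxm : x ^ (2 * M₀ + 1) ≠ 1 := fun h => by
    obtain ⟨i, _, hi⟩ := hz.eq_pow_of_pow_eq_one h
    exact h1 i hi.symm
  have e1 : 1 - x ^ (2 * M₀ + 1) ≠ 0 := sub_ne_zero.mpr hxm.symm
  have e2 : 1 - 1 / x ^ (2 * M₀ + 1) ≠ 0 := sub_ne_zero.mpr fun h => hxm (by
    rw [eq_div_iff (pow_ne_zero _ hx), one_mul] at h
    exact h)
  have e3 : qInteger z (6 * (2 * M₀ + 1 + k) + 1) = qInteger z (6 * k + 1) := by
    apply mul_right_cancel₀ hz1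
    rw [qInteger_mul_one_sub, qInteger_mul_one_sub,
      show 6 * (2 * M₀ + 1 + k) + 1 = (2 * M₀ + 1) * 6 + (6 * k + 1) by ring, pow_add, pow_mul,
      hz.pow_eq_one, one_pow, one_mul]
  have e4 : z ^ ((2 * M₀ + 1 + k) ^ 2) = z ^ k ^ 2 := by
    rw [show (2 * M₀ + 1 + k) ^ 2 = (2 * M₀ + 1) * (2 * M₀ + 1 + 2 * k) + k ^ 2 by ring, pow_add,
      pow_mul, hz.pow_eq_one, one_pow, one_mul]
  rw [deformedCoeff, deformedCoeff, e3, e4, qShifted_primitiveRoot_add hm hz2,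
    qShifted_primitiveRoot_add hm hz2, qShifted_primitiveRoot_add hm hz4,
    qShifted_primitiveRoot_add hm hz4, mul_pow, mul_pow, div_pow, div_pow, hz.pow_eq_one,
    hz4.pow_eq_one, mul_one]
  congr 1
  rw [mul_mul_mul_comm, mul_mul_mul_comm (1 - x ^ (2 * M₀ + 1)) (qShifted (x * z ^ 4) (z ^ 4) k),
    mul_div_mul_left _ _ (mul_ne_zero e1 e2)]

variable {g : ℕ → K}

theorem one_sub_pow_ne_zero_of_lt (hz : IsPrimitiveRoot z (2 * M₀ + 1)) {t : ℕ}
    (ht : t + 1 < 2 * M₀ + 1) : 1 - z ^ (4 * t + 4) ≠ 0 := by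
  refine sub_ne_zero.mpr fun h => ?_
  have hdvd : 2 * M₀ + 1 ∣ 4 * (t + 1) := (hz.pow_eq_one_iff_dvd _).mp h.symm
  have hcop : Nat.Coprime (2 * M₀ + 1) 4 :=
    Nat.Coprime.pow_right 2 (by simp : Nat.Coprime (2 * M₀ + 1) 2)
  have := Nat.le_of_dvd (by omega) (hcop.dvd_of_dvd_mul_left hdvd)
  omega

/-- Here g stands for the values at z of the regular extension of `centralCoeff`, which is 0/0 as
written once k reaches the order m of z. The recursion has m-periodic coefficients and determines g
inside a block; its leading coefficient vanishes only on entering the next one. -/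
theorem central_rec_block (hz : IsPrimitiveRoot z (2 * M₀ + 1)) (g0 : g 0 = 1)
    (hg : ∀ k, (1 - z ^ (4 * k + 4)) * g (k + 1) = (1 - z ^ (4 * k + 2)) * g k) (s t : ℕ)
    (ht : t < 2 * M₀ + 1) :
    g ((2 * M₀ + 1) * s + t) = g ((2 * M₀ + 1) * s) * g t := by
  induction t with
  | zero => rw [add_zero, g0, mul_one]
  | succ t ih =>
    have hp : ∀ c, z ^ (4 * ((2 * M₀ + 1) * s + t) + c) = z ^ (4 * t + c) := fun c => by
      rw [show 4 * ((2 * M₀ + 1) * s + t) + c = (2 * M₀ + 1) * (4 * s) + (4 * t + c) by ring,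
        pow_add, pow_mul, hz.pow_eq_one, one_pow, one_mul]
    apply mul_left_cancel₀ (one_sub_pow_ne_zero_of_lt hz ht)
    have h := hg ((2 * M₀ + 1) * s + t)
    rw [hp, hp, ih (by omega)] at h
    rw [← add_assoc, h, mul_left_comm, ← hg t]
    ring

theorem central_rec_eq (hz : IsPrimitiveRoot z (2 * M₀ + 1)) (g0 : g 0 = 1)
    (hg : ∀ k, (1 - z ^ (4 * k + 4)) * g (k + 1) = (1 - z ^ (4 * k + 2)) * g k) (t : ℕ)
    (ht : t < 2 * M₀ + 1) : g t = centralCoeff z t := by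
  induction t with
  | zero => simp [centralCoeff, g0]
  | succ t ih =>
    have hne := one_sub_pow_ne_zero_of_lt hz ht
    apply mul_left_cancel₀ hne
    rw [hg t, ih (by omega), centralCoeff, centralCoeff, qShifted_succ, qShifted_succ,
      show z ^ 2 * (z ^ 4) ^ t = z ^ (4 * t + 2) by ring,
      show z ^ 4 * (z ^ 4) ^ t = z ^ (4 * t + 4) by ring, ← div_mul_div_comm]
    field_simp

/-- At k = M₀ the coefficient 1 - z^(4k+2) vanishes, which kills g for the rest of the block. -/
theorem central_rec_eq_zero (hz : IsPrimitiveRoot z (2 * M₀ + 1))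
    (hg : ∀ k, (1 - z ^ (4 * k + 4)) * g (k + 1) = (1 - z ^ (4 * k + 2)) * g k) (t : ℕ)
    (ht : M₀ + 1 + t < 2 * M₀ + 1) : g (M₀ + 1 + t) = 0 := by
  induction t with
  | zero =>
    apply (mul_eq_zero.mp _).resolve_left (one_sub_pow_ne_zero_of_lt hz ht)
    rw [add_zero, hg, show 4 * M₀ + 2 = (2 * M₀ + 1) * 2 by ring, pow_mul, hz.pow_eq_one]
    simp
  | succ t ih =>
    have h := hg (M₀ + 1 + t)
    rw [ih (by omega), mul_zero] at h
    exact (mul_eq_zero.mp h).resolve_left (one_sub_pow_ne_zero_of_lt hz ht)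

/-- Periodicity and `central_rec_block` make the block a multiple of the first one, whose first half
is a vanishing `deformedSum` and whose second half vanishes termwise. -/
theorem sum_block_eq_zero (hM : 1 ≤ M₀) (hz : IsPrimitiveRoot z (2 * M₀ + 1))
    (hx : x ≠ 0) (h1 : ∀ i : ℕ, x ≠ z ^ i) (h2 : ∀ i : ℕ, x * z ^ i ≠ 1) (g0 : g 0 = 1)
    (hg : ∀ k, (1 - z ^ (4 * k + 4)) * g (k + 1) = (1 - z ^ (4 * k + 2)) * g k) (s L : ℕ)
    (hL : L = M₀ + 1 ∨ L = 2 * M₀ + 1) :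
    ∑ t ∈ range L, deformedCoeff x z ((2 * M₀ + 1) * s + t) * g ((2 * M₀ + 1) * s + t) = 0 := by
  have hper : ∀ s t, deformedCoeff x z ((2 * M₀ + 1) * s + t) = deformedCoeff x z t := by
    intro s t
    induction s with
    | zero => simp
    | succ s ih =>
      rw [show (2 * M₀ + 1) * (s + 1) + t = 2 * M₀ + 1 + ((2 * M₀ + 1) * s + t) by ring,
        deformedCoeff_add_period hM hz hx h1, ih]
  have hhalf : ∑ t ∈ range (M₀ + 1), deformedCoeff x z t * g t = 0 := by
    rw [← deformedSum_eq_zero_of_isPrimitiveRoot hM hz hx h1 h2, deformedSum_eq_sum]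
    refine sum_congr rfl fun t ht => ?_
    rw [central_rec_eq hz g0 hg t (by have := mem_range.mp ht; omega)]
  have hsum : ∑ t ∈ range L, deformedCoeff x z t * g t = 0 := by
    rcases hL with rfl | rfl
    · exact hhalf
    · rw [show 2 * M₀ + 1 = M₀ + 1 + M₀ by ring, sum_range_add, hhalf, zero_add]
      refine sum_eq_zero fun t ht => ?_
      rw [central_rec_eq_zero hz hg t (by have := mem_range.mp ht; omega), mul_zero]
  rw [← mul_zero (g ((2 * M₀ + 1) * s)), ← hsum, mul_sum]
  refine sum_congr rfl fun t ht => ?_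
  rw [hper, central_rec_block hz g0 hg s t (by have := mem_range.mp ht; omega)]
  ring

/-- Vanishing, at a root of unity `z`, of the sums `deformedSum` whose length is compatible with
the order of `z`. -/
theorem sum_deformedCoeff_mul_eq_zero {N d : ℕ} (hN : Odd N) (hzN : z ^ N = 1) (hz1 : z ≠ 1)
    (hd : d = 1 ∨ d = 2)
    (hx : x ≠ 0) (h1 : ∀ i : ℕ, x ≠ z ^ i) (h2 : ∀ i : ℕ, x * z ^ i ≠ 1) (g0 : g 0 = 1)
    (hg : ∀ k, (1 - z ^ (4 * k + 4)) * g (k + 1) = (1 - z ^ (4 * k + 2)) * g k) :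
    ∑ k ∈ range ((N - 1) / d + 1), deformedCoeff x z k * g k = 0 := by
  obtain ⟨s, hs⟩ := orderOf_dvd_of_pow_eq_one hzN
  have hodd : Odd (orderOf z) ∧ Odd s := Nat.odd_mul.mp (hs ▸ hN)
  obtain ⟨⟨M₀, hM₀⟩, ⟨s', hs'⟩⟩ := hodd
  have hz := IsPrimitiveRoot.orderOf z
  rw [hM₀] at hz hs
  have hM : 1 ≤ M₀ := by
    rcases Nat.eq_zero_or_pos M₀ with rfl | h
    · exact absurd (orderOf_eq_one_iff.mp hM₀) hz1
    · exact h
  have hfull : ∀ r, ∑ k ∈ range ((2 * M₀ + 1) * r), deformedCoeff x z k * g k = 0 := by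
    intro r
    induction r with
    | zero => simp
    | succ r ih =>
      rw [mul_add, mul_one, sum_range_add, ih, zero_add]
      exact sum_block_eq_zero hM hz hx h1 h2 g0 hg r _ (Or.inr rfl)
  have hN0 : 0 < N := hN.pos
  rcases hd with rfl | rfl
  · rw [Nat.div_one, Nat.sub_add_cancel hN0, hs]
    exact hfull s
  -- With N = m(2s'+1), half the range consists of s' full blocks and one half block of M₀ + 1
  -- terms.
  · have : (N - 1) / 2 + 1 = (2 * M₀ + 1) * s' + (M₀ + 1) := by
      have h : N = 2 * ((2 * M₀ + 1) * s' + M₀) + 1 := by rw [hs, hs']; ring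
      omega
    rw [this, sum_range_add, hfull, zero_add]
    exact sum_block_eq_zero hM hz hx h1 h2 g0 hg s' _ (Or.inl rfl)

end Blocks

/-! ### Values of fractions that are regular at the kernel of a ring homomorphism. -/

section Specialization

set_option linter.unusedSectionVars false

variable {R K L : Type*} [CommRing R] [Field K] [Algebra R K] [IsFractionRing R K] [Field L]

/-- The fraction `x` of elements of `R` is regular at the kernel of `φ`, and the extension of `φ`
to such fractions sends it to `y`. -/
def SpecializesTo (φ : R →+* L) (x : K) (y : L) : Prop :=
  ∃ u v : R, φ v ≠ 0 ∧ x = algebraMap R K u / algebraMap R K v ∧ y = φ u / φ v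

namespace SpecializesTo

variable {φ : R →+* L} {x x' : K} {y y' : L}

theorem algebraMap_ne_zero {v : R} (h : φ v ≠ 0) : algebraMap R K v ≠ 0 := fun h0 => h (by
  rw [(map_eq_zero_iff _ (IsFractionRing.injective R K)).mp h0, map_zero])

theorem of_algebraMap (φ : R →+* L) (u : R) : SpecializesTo φ (algebraMap R K u) (φ u) :=
  ⟨u, 1, by simp, by simp, by simp⟩

theorem one (φ : R →+* L) : SpecializesTo φ (1 : K) 1 := by
  simpa using of_algebraMap (K := K) φ 1

theorem zero (φ : R →+* L) : SpecializesTo φ (0 : K) 0 := by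
  simpa using of_algebraMap (K := K) φ 0

theorem add (h : SpecializesTo φ x y) (h' : SpecializesTo φ x' y') :
    SpecializesTo φ (x + x') (y + y') := by
  obtain ⟨u, v, hv, rfl, rfl⟩ := h
  obtain ⟨u', v', hv', rfl, rfl⟩ := h'
  refine ⟨u * v' + v * u', v * v', by simpa using ⟨hv, hv'⟩, ?_, ?_⟩
  · simp only [map_add, map_mul]
    exact div_add_div _ _ (algebraMap_ne_zero hv) (algebraMap_ne_zero hv')
  · simp only [map_add, map_mul]
    exact div_add_div _ _ hv hv'

theorem neg (h : SpecializesTo φ x y) : SpecializesTo φ (-x) (-y) := by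
  obtain ⟨u, v, hv, rfl, rfl⟩ := h
  exact ⟨-u, v, hv, by rw [map_neg, neg_div], by rw [map_neg, neg_div]⟩

theorem sub (h : SpecializesTo φ x y) (h' : SpecializesTo φ x' y') :
    SpecializesTo φ (x - x') (y - y') := by
  rw [sub_eq_add_neg, sub_eq_add_neg]
  exact h.add h'.neg

theorem mul (h : SpecializesTo φ x y) (h' : SpecializesTo φ x' y') :
    SpecializesTo φ (x * x') (y * y') := by
  obtain ⟨u, v, hv, rfl, rfl⟩ := h
  obtain ⟨u', v', hv', rfl, rfl⟩ := h'
  refine ⟨u * u', v * v', by simpa using ⟨hv, hv'⟩, ?_, ?_⟩ <;>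
  simp only [map_mul, div_mul_div_comm]

theorem inv (h : SpecializesTo φ x y) (hy : y ≠ 0) : SpecializesTo φ x⁻¹ y⁻¹ := by
  obtain ⟨u, v, hv, rfl, rfl⟩ := h
  exact ⟨v, u, (div_ne_zero_iff.mp hy).1, by rw [inv_div], by rw [inv_div]⟩

theorem div (h : SpecializesTo φ x y) (h' : SpecializesTo φ x' y') (hy : y' ≠ 0) :
    SpecializesTo φ (x / x') (y / y') := by
  rw [div_eq_mul_inv, div_eq_mul_inv]
  exact h.mul (h'.inv hy)

theorem pow (h : SpecializesTo φ x y) (n : ℕ) : SpecializesTo φ (x ^ n) (y ^ n) := by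
  obtain ⟨u, v, hv, rfl, rfl⟩ := h
  exact ⟨u ^ n, v ^ n, by simpa using fun h => absurd h hv, by simp [div_pow], by simp [div_pow]⟩

theorem sum {ι : Type*} {s : Finset ι} {f : ι → K} {g : ι → L}
    (h : ∀ i ∈ s, SpecializesTo φ (f i) (g i)) :
    SpecializesTo φ (∑ i ∈ s, f i) (∑ i ∈ s, g i) := by
  classical
  induction s using Finset.induction_on with
  | empty => simpa using zero φ
  | insert i s hi ih =>
    rw [sum_insert hi, sum_insert hi]
    exact (h i (mem_insert_self i s)).add (ih fun j hj => h j (mem_insert_of_mem hj))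

theorem prod {ι : Type*} {s : Finset ι} {f : ι → K} {g : ι → L}
    (h : ∀ i ∈ s, SpecializesTo φ (f i) (g i)) :
    SpecializesTo φ (∏ i ∈ s, f i) (∏ i ∈ s, g i) := by
  classical
  induction s using Finset.induction_on with
  | empty => simpa using one φ
  | insert i s hi ih =>
    rw [prod_insert hi, prod_insert hi]
    exact (h i (mem_insert_self i s)).mul (ih fun j hj => h j (mem_insert_of_mem hj))

theorem unique (h : SpecializesTo φ x y) (h' : SpecializesTo φ x y') : y = y' := by
  obtain ⟨u, v, hv, hx, rfl⟩ := h
  obtain ⟨u', v', hv', hx', rfl⟩ := h'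
  rw [hx', div_eq_div_iff (algebraMap_ne_zero hv') (algebraMap_ne_zero hv), ← map_mul,
    ← map_mul] at hx
  have h := congrArg φ (IsFractionRing.injective R K hx)
  rw [map_mul, map_mul] at h
  rw [div_eq_div_iff hv hv', h]

theorem qShifted (h : SpecializesTo φ x y) (h' : SpecializesTo φ x' y') (k : ℕ) :
    SpecializesTo φ (qShifted x x' k) (qShifted y y' k) :=
  prod fun i _ => (one φ).sub (h.mul (h'.pow i))

theorem qInteger (h : SpecializesTo φ x y) (m : ℕ) :
    SpecializesTo φ (qInteger x m) (qInteger y m) :=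
  sum fun i _ => h.pow i

theorem deformedCoeff (h : SpecializesTo φ x y) (h' : SpecializesTo φ x' y') (hy : y ≠ 0)
    (h1 : ∀ i : ℕ, y ≠ y' ^ i) (h2 : ∀ i : ℕ, y * y' ^ i ≠ 1) (k : ℕ) :
    SpecializesTo φ (deformedCoeff x x' k) (deformedCoeff y y' k) := by
  refine ((h'.pow _).mul (h'.qInteger _)).mul
    ((((h.mul h').qShifted (h'.pow 2) k).mul ((h'.div h hy).qShifted (h'.pow 2) k)).div
    (((h.mul (h'.pow 4)).qShifted (h'.pow 4) k).mul
      (((h'.pow 4).div h hy).qShifted (h'.pow 4) k)) ?_)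
  refine mul_ne_zero (qShifted_ne_zero fun i _ => sub_ne_zero.mpr fun h => ?_)
    (qShifted_ne_zero fun i _ => sub_ne_zero.mpr fun h => ?_)
  · exact h2 (4 + 4 * i) (by rw [h]; ring)
  · refine h1 (4 + 4 * i) ?_
    field_simp at h
    rw [h]
    ring

theorem centralCoeff (h : SpecializesTo φ x y) (h1 : ∀ i : ℕ, y ^ (i + 1) ≠ 1) (k : ℕ) :
    SpecializesTo φ (centralCoeff x k) (centralCoeff y k) := by
  refine ((h.pow 2).qShifted (h.pow 4) k).div ((h.pow 4).qShifted (h.pow 4) k)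
    (qShifted_ne_zero fun i _ => sub_ne_zero.mpr fun h => ?_)
  exact h1 (4 * i + 3) (by rw [h]; ring)

theorem deformedSum (h : SpecializesTo φ x y) (h' : SpecializesTo φ x' y') (hy : y ≠ 0)
    (h1 : ∀ i : ℕ, y ≠ y' ^ (4 * i + 4)) (h2 : ∀ i : ℕ, y * y' ^ (4 * i + 4) ≠ 1)
    (h3 : ∀ i : ℕ, y' ^ (i + 1) ≠ 1) (M : ℕ) :
    SpecializesTo φ (deformedSum x x' M) (deformedSum y y' M) := by
  refine sum fun k _ => ((h'.pow _).mul (h'.qInteger _)).mul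
    (((((h.mul h').qShifted (h'.pow 2) k).mul ((h'.div h hy).qShifted (h'.pow 2) k)).mul
      ((h'.pow 2).qShifted (h'.pow 4) k)).div
    ((((h.mul (h'.pow 4)).qShifted (h'.pow 4) k).mul
      (((h'.pow 4).div h hy).qShifted (h'.pow 4) k)).mul
      ((h'.pow 4).qShifted (h'.pow 4) k)) ?_)
  refine mul_ne_zero (mul_ne_zero (qShifted_ne_zero fun i _ => sub_ne_zero.mpr fun h => ?_)
    (qShifted_ne_zero fun i _ => sub_ne_zero.mpr fun h => ?_))
    (qShifted_ne_zero fun i _ => sub_ne_zero.mpr fun h => ?_)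
  · exact h2 i (by rw [h]; ring)
  · refine h1 i ?_
    field_simp at h
    rw [h]
    ring
  · exact h3 (4 * i + 3) (by rw [h]; ring)

end SpecializesTo

section Central

variable {A : Type*} [CommRing A]

/-- Gaussian binomials are polynomials, by the q-Pascal splitting 1 - q^(k+l) = (1 - q^k) + q^k (1 -
q^l). -/
theorem qShifted_mul_dvd (q : A) (k l : ℕ) :
    qShifted q q k * qShifted q q l ∣ qShifted q q (k + l) := by
  obtain ⟨s, hs⟩ : ∃ s, s = k + l := ⟨_, rfl⟩
  induction s generalizing k l with
  | zero =>
    obtain ⟨rfl, rfl⟩ : k = 0 ∧ l = 0 := by omega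
    simp
  | succ s ih =>
    rcases k with _ | k
    · simp
    rcases l with _ | l
    · simp
    have e : 1 - q * q ^ (k + 1 + l) = (1 - q * q ^ k) + q ^ (k + 1) * (1 - q * q ^ l) := by ring
    rw [← add_assoc, qShifted_succ q q (k + 1 + l), e, mul_add]
    refine dvd_add ?_ ?_
    · rw [show k + 1 + l = k + (l + 1) by ring, qShifted_succ q q k, mul_right_comm]
      exact mul_dvd_mul_right (ih k (l + 1) (by omega)) _
    · rw [qShifted_succ q q l, ← mul_assoc, mul_left_comm, ← mul_assoc]
      exact (mul_dvd_mul_right (ih (k + 1) l (by omega)) _).trans ⟨q ^ (k + 1), by ring⟩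

theorem qShifted_two_mul (q : A) (k : ℕ) :
    qShifted (q ^ 2) (q ^ 2) (k + k) = qShifted (q ^ 2) (q ^ 4) k * qShifted (q ^ 4) (q ^ 4) k := by
  induction k with
  | zero => simp
  | succ k ih =>
    rw [show k + 1 + (k + 1) = k + k + 1 + 1 by ring, qShifted_succ, qShifted_succ, ih,
      qShifted_succ, qShifted_succ]
    ring

theorem qShifted_sq (q : A) (k : ℕ) :
    qShifted (q ^ 4) (q ^ 4) k = qShifted (q ^ 2) (q ^ 2) k * qShifted (-q ^ 2) (q ^ 2) k := by
  rw [qShifted, qShifted, qShifted, ← prod_mul_distrib]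
  exact prod_congr rfl fun i _ => by ring

end Central

/-- The quotient equals the Gaussian binomial (2k choose k) in base q^2, divided by (-q^2; q^2)_k^2.
Thus a pole requires some power of φ q to be -1. -/
theorem exists_specializesTo_centralCoeff {φ : R →+* L} {q : R}
    (hq : ∀ i : ℕ, q ^ (i + 1) ≠ 1) (h : ∀ i : ℕ, φ q ^ i ≠ -1) (k : ℕ) :
    ∃ y, SpecializesTo φ (centralCoeff (algebraMap R K q) k) y := by
  obtain ⟨c, hc⟩ := qShifted_mul_dvd (q ^ 2) k k
  have hinj := IsFractionRing.injective R K
  have hK : ∀ i : ℕ, algebraMap R K q ^ (i + 1) ≠ 1 := fun i h => hq i (hinj (by simpa using h))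
  have hφ : φ (qShifted (-q ^ 2) (q ^ 2) k ^ 2) ≠ 0 := by
    rw [map_pow, map_qShifted]
    refine pow_ne_zero 2 (qShifted_ne_zero fun i _ => sub_ne_zero.mpr fun he => ?_)
    refine h (2 + 2 * i) ?_
    simp only [map_neg, map_pow] at he
    linear_combination he
  refine ⟨_, c, qShifted (-q ^ 2) (q ^ 2) k ^ 2, hφ, ?_, rfl⟩
  have e1 := congrArg (algebraMap R K) (qShifted_two_mul q k)
  have e2 := congrArg (algebraMap R K) (qShifted_sq q k)
  have e3 := congrArg (algebraMap R K) hc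
  have hb := SpecializesTo.algebraMap_ne_zero (K := K) hφ
  simp only [map_mul, map_qShifted, map_pow, map_neg] at e1 e2 e3 hb ⊢
  set Q := algebraMap R K q
  have h4 : _root_.qShifted (Q ^ 4) (Q ^ 4) k ≠ 0 :=
    qShifted_ne_zero fun i _ => sub_ne_zero.mpr fun he => hK (4 * i + 3) (by rw [he]; ring)
  rw [centralCoeff, div_eq_div_iff h4 hb]
  have h2 : _root_.qShifted (Q ^ 2) (Q ^ 2) k ≠ 0 := fun h0 => h4 (by rw [e2, h0, zero_mul])
  apply mul_right_cancel₀ h4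
  rw [mul_right_comm, ← e1, e3, e2]
  ring

end Specialization

/-! ### Gluing congruences over coprime moduli. -/

section RatCongr

/-- The witnesses u, v may change with the modulus; lowest terms give one fraction to test against
all moduli, as gluing requires. -/
theorem ratCongr_iff {P : PolyQA} {A B : RatQA} :
    RatCongr P A B ↔ P ∣ IsFractionRing.num PolyQA (A - B) ∧
      IsRelPrime (IsFractionRing.den PolyQA (A - B) : PolyQA) P := by
  have hinj := IsFractionRing.injective PolyQA RatQA
  have hden : (IsFractionRing.den PolyQA (A - B) : PolyQA) ≠ 0 :=
    nonZeroDivisors.coe_ne_zero _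
  have hden' : algebraMap PolyQA RatQA (IsFractionRing.den PolyQA (A - B) : PolyQA) ≠ 0 :=
    (map_ne_zero_iff _ hinj).mpr hden
  have hfrac := IsFractionRing.mk'_num_den' (A := PolyQA) (A - B)
  have hred := IsFractionRing.num_den_reduced PolyQA (A - B)
  refine ⟨?_, fun ⟨h1, h2⟩ => ⟨_, _, hden, h1, h2, hfrac.symm⟩⟩
  rintro ⟨u, v, hv, hPu, hrel, huv⟩
  have hv' : algebraMap PolyQA RatQA v ≠ 0 := (map_ne_zero_iff _ hinj).mpr hv
  have hcross : IsFractionRing.num PolyQA (A - B) * v =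
      u * (IsFractionRing.den PolyQA (A - B) : PolyQA) := by
    apply hinj
    rw [map_mul, map_mul, ← div_eq_div_iff hden' hv', hfrac, huv]
  have hdv : (IsFractionRing.den PolyQA (A - B) : PolyQA) ∣ v :=
    hred.symm.dvd_of_dvd_mul_left ⟨u, by rw [hcross, mul_comm]⟩
  refine ⟨?_, hrel.of_dvd_left hdv⟩
  exact hrel.symm.dvd_of_dvd_mul_right (hcross ▸ hPu.mul_right _)

theorem RatCongr.mul {P Q : PolyQA} {A B : RatQA} (hP : RatCongr P A B) (hQ : RatCongr Q A B)
    (h : IsRelPrime P Q) : RatCongr (P * Q) A B := by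
  rw [ratCongr_iff] at *
  exact ⟨h.mul_dvd hP.1 hQ.1, hP.2.mul_right hQ.2⟩

theorem RatCongr.prod {ι : Type*} {s : Finset ι} {P : ι → PolyQA} {A B : RatQA}
    (hP : ∀ i ∈ s, RatCongr (P i) A B)
    (h : ∀ i ∈ s, ∀ j ∈ s, i ≠ j → IsRelPrime (P i) (P j)) :
    RatCongr (∏ i ∈ s, P i) A B := by
  classical
  induction s using Finset.induction_on with
  | empty =>
    rw [ratCongr_iff]
    simpa using isRelPrime_one_right
  | insert i s hi ih =>
    rw [prod_insert hi]
    refine (hP i (mem_insert_self i s)).mul (ih (fun j hj => hP j (mem_insert_of_mem hj))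
      fun j hj k hk => h j (mem_insert_of_mem hj) k (mem_insert_of_mem hk)) ?_
    exact IsRelPrime.prod_right fun j hj => h i (mem_insert_self i s) j (mem_insert_of_mem hj)
      fun hij => hi (hij ▸ hj)

/-- `π` generates the kernel of the ring homomorphism `φ`. -/
structure IsKernelGenerator {L : Type*} [Field L] (φ : PolyQA →+* L) (π : PolyQA) : Prop where
  ne_zero : π ≠ 0
  map_eq_zero : φ π = 0
  dvd : ∀ u, φ u = 0 → π ∣ u

namespace IsKernelGenerator

variable {L : Type*} [Field L] {φ : PolyQA →+* L} {π : PolyQA}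

theorem prime (h : IsKernelGenerator φ π) : Prime π := by
  refine ⟨h.ne_zero, fun hu => ?_, fun a b hab => ?_⟩
  · exact (hu.map φ).ne_zero h.map_eq_zero
  · obtain ⟨c, hc⟩ := hab
    have : φ a * φ b = 0 := by rw [← map_mul, hc, map_mul, h.map_eq_zero, zero_mul]
    exact (mul_eq_zero.mp this).imp (h.dvd a) (h.dvd b)

theorem isRelPrime (h : IsKernelGenerator φ π) {v : PolyQA} (hv : φ v ≠ 0) : IsRelPrime π v :=
  h.prime.irreducible.isRelPrime_iff_not_dvd.mpr fun ⟨c, hc⟩ =>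
    hv (by rw [hc, map_mul, h.map_eq_zero, zero_mul])

theorem ratCongr (h : IsKernelGenerator φ π) {A B : RatQA} (hAB : SpecializesTo φ (A - B) 0) :
    RatCongr π A B := by
  obtain ⟨u, v, hv, huv, h0⟩ := hAB
  refine ⟨u, v, fun h => hv (by rw [h, map_zero]), h.dvd u ?_, (h.isRelPrime hv).symm, huv⟩
  exact (div_eq_zero_iff.mp h0.symm).resolve_right hv

end IsKernelGenerator

end RatCongr

/-! ### Evaluations whose kernels are generated by the prime factors of the modulus. -/

section Evaluations

/-- The evaluation `q ↦ z`, `a ↦ x`. -/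
noncomputable def evalQA {L : Type*} [CommRing L] (z x : L) : PolyQA →+* L :=
  eval₂RingHom (eval₂RingHom (Int.castRingHom L) z) x

section

variable {L : Type*} [CommRing L] (z x : L)

@[simp]
theorem evalQA_polyQ : evalQA z x polyQ = z := by simp [evalQA, polyQ]

@[simp]
theorem evalQA_polyA : evalQA z x polyA = x := by simp [evalQA, polyA]

theorem evalQA_C (c : ℤ[X]) : evalQA z x (C c) = eval₂ (Int.castRingHom L) z c := by
  simp [evalQA]

end

theorem evalQA_algebraMap_C (c : ℤ[X]) (x : FractionRing ℤ[X]) :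
    evalQA (algebraMap ℤ[X] (FractionRing ℤ[X]) X) x (C c) =
      algebraMap ℤ[X] (FractionRing ℤ[X]) c := by
  have : eval₂RingHom (Int.castRingHom (FractionRing ℤ[X]))
      (algebraMap ℤ[X] (FractionRing ℤ[X]) X) = algebraMap ℤ[X] (FractionRing ℤ[X]) := by
    refine Polynomial.ringHom_ext' (RingHom.ext_int _ _) ?_
    rw [coe_eval₂RingHom, eval₂_X]
  rw [evalQA_C]
  exact DFunLike.congr_fun this c

theorem isKernelGenerator_sub (N : ℕ) :
    IsKernelGenerator (evalQA (algebraMap ℤ[X] (FractionRing ℤ[X]) X)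
      (algebraMap ℤ[X] (FractionRing ℤ[X]) X ^ N)) (polyA - polyQ ^ N) where
  ne_zero := by
    rw [polyA, polyQ, ← C_pow]
    exact X_sub_C_ne_zero _
  map_eq_zero := by simp
  dvd u hu := by
    rw [polyA, polyQ, ← C_pow, dvd_iff_isRoot, IsRoot]
    apply IsFractionRing.injective ℤ[X] (FractionRing ℤ[X])
    rw [map_zero, ← hu]
    have : (algebraMap ℤ[X] (FractionRing ℤ[X])).comp (evalRingHom (X ^ N)) =
        evalQA (algebraMap ℤ[X] (FractionRing ℤ[X]) X)
          (algebraMap ℤ[X] (FractionRing ℤ[X]) X ^ N) := by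
      refine Polynomial.ringHom_ext (fun c => ?_) ?_
      · rw [evalQA_algebraMap_C]
        simp
      · simp [evalQA]
    rw [← this]
    rfl

/-- Division by 1 - aQ, which is not monic in a: multiplying by a power of Q allows every aQ to be
replaced by 1. -/
theorem exists_pow_mul_eq (Q : ℤ[X]) (u : PolyQA) :
    ∃ (k : ℕ) (w : PolyQA) (c : ℤ[X]), C Q ^ k * u = (1 - X * C Q) * w + C c := by
  induction u using Polynomial.induction_on' with
  | add p r hp hr =>
    obtain ⟨k, w, c, h⟩ := hp
    obtain ⟨k', w', c', h'⟩ := hr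
    refine ⟨k + k', C Q ^ k' * w + C Q ^ k * w', Q ^ k' * c + Q ^ k * c', ?_⟩
    simp only [C_add, C_mul, C_pow]
    linear_combination C Q ^ k' * h + C Q ^ k * h'
  | monomial n b =>
    obtain ⟨w, hw⟩ := sub_dvd_pow_sub_pow (1 : PolyQA) (X * C Q) n
    refine ⟨n, -w * C b, b, ?_⟩
    rw [← C_mul_X_pow_eq_monomial]
    rw [one_pow, mul_pow] at hw
    linear_combination -C b * hw

theorem isKernelGenerator_one_sub (N : ℕ) :
    IsKernelGenerator (evalQA (algebraMap ℤ[X] (FractionRing ℤ[X]) X)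
      (algebraMap ℤ[X] (FractionRing ℤ[X]) X ^ N)⁻¹) (1 - polyA * polyQ ^ N) where
  ne_zero h := by
    have := congrArg (evalQA (0 : ℤ) 0) h
    rcases Nat.eq_zero_or_pos N with rfl | hN <;> simp at this
  map_eq_zero := by
    have : algebraMap ℤ[X] (FractionRing ℤ[X]) X ≠ 0 :=
      (map_ne_zero_iff _ (IsFractionRing.injective _ _)).mpr X_ne_zero
    simp [this]
  dvd u hu := by
    have hX : algebraMap ℤ[X] (FractionRing ℤ[X]) X ≠ 0 :=
      (map_ne_zero_iff _ (IsFractionRing.injective _ _)).mpr X_ne_zero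
    obtain ⟨k, w, c, h⟩ := exists_pow_mul_eq (X ^ N) u
    have hc := congrArg (evalQA (algebraMap ℤ[X] (FractionRing ℤ[X]) X)
      (algebraMap ℤ[X] (FractionRing ℤ[X]) X ^ N)⁻¹) h
    have hA : evalQA (algebraMap ℤ[X] (FractionRing ℤ[X]) X)
      (algebraMap ℤ[X] (FractionRing ℤ[X]) X ^ N)⁻¹ X =
      (algebraMap ℤ[X] (FractionRing ℤ[X]) X ^ N)⁻¹ := evalQA_polyA _ _
    rw [map_mul, hu, mul_zero, map_add, map_mul, map_sub, map_one, map_mul, hA,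
      evalQA_algebraMap_C, evalQA_algebraMap_C, map_pow,
      inv_mul_cancel₀ (pow_ne_zero N hX), sub_self, zero_mul, zero_add] at hc
    have hc0 : c = 0 := IsFractionRing.injective ℤ[X] (FractionRing ℤ[X]) (by rw [← hc, map_zero])
    rw [hc0, C_0, add_zero] at h
    -- The power of q introduced by the division is harmless: 1 = (1 - a q^N) + a q^N.
    have hcop : IsCoprime (1 - X * C (X ^ N) : PolyQA) (C (X ^ N)) := ⟨1, X, by ring⟩
    rw [polyA, polyQ, ← C_pow]
    exact (hcop.pow_right (n := k)).dvd_of_dvd_mul_left ⟨w, h⟩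

/-- With a kept transcendental over ℂ, the kernel is tested coefficientwise in a, and Φ_m is the
minimal polynomial of ζ over ℤ. -/
theorem isKernelGenerator_cyclotomic {ζ : ℂ} {m : ℕ} (hm : 0 < m) (hζ : IsPrimitiveRoot ζ m) :
    IsKernelGenerator (evalQA (algebraMap ℂ[X] (FractionRing ℂ[X]) (C ζ))
      (algebraMap ℂ[X] (FractionRing ℂ[X]) X)) (C (cyclotomic m ℤ)) := by
  have hφ : evalQA (algebraMap ℂ[X] (FractionRing ℂ[X]) (C ζ))
      (algebraMap ℂ[X] (FractionRing ℂ[X]) X) = (algebraMap ℂ[X] (FractionRing ℂ[X])).comp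
        (mapRingHom (eval₂RingHom (Int.castRingHom ℂ) ζ)) := by
    refine Polynomial.ringHom_ext' ?_ ?_
    · refine Polynomial.ringHom_ext' ?_ ?_
      · exact RingHom.ext_int _ _
      · simp [evalQA]
    · simp [evalQA]
  have hinj := IsFractionRing.injective ℂ[X] (FractionRing ℂ[X])
  refine ⟨by simpa using cyclotomic_ne_zero m ℤ, ?_, fun u hu => ?_⟩
  · rw [hφ, RingHom.comp_apply, coe_mapRingHom, map_C, coe_eval₂RingHom,
      eval₂_eq_eval_map, map_cyclotomic]
    rw [(hζ.isRoot_cyclotomic hm).eq_zero, C_0, map_zero]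
  · rw [hφ, RingHom.comp_apply, map_eq_zero_iff _ hinj, coe_mapRingHom] at hu
    rw [C_dvd_iff_dvd_coeff]
    intro i
    rw [cyclotomic_eq_minpoly hζ hm]
    refine minpoly.isIntegrallyClosed_dvd (hζ.isIntegral hm) ?_
    have := congrArg (fun p => coeff p i) hu
    simpa [coeff_map, aeval_def] using this

end Evaluations

/-! ### Specializing the two sides and assembling the congruence. -/

section Main

theorem neg_pow_zpow {K : Type*} [Field K] (q : K) (h : ℕ) :
    (-q) ^ ((1 - ((2 * h + 1 : ℕ) : ℤ)) / 2) = ((-q) ^ h)⁻¹ := by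
  rw [show (1 - ((2 * h + 1 : ℕ) : ℤ)) / 2 = -(h : ℤ) by push_cast; omega, zpow_neg, zpow_natCast]

theorem qInteger_mul {R : Type*} [CommRing R] (q : R) (m n : ℕ) :
    qInteger q (m * n) = qInteger q m * qInteger (q ^ m) n := by
  induction n with
  | zero => simp [qInteger]
  | succ n ih =>
    have h1 : qInteger (q ^ m) (n + 1) = qInteger (q ^ m) n + (q ^ m) ^ n := by
      simp [qInteger, sum_range_succ]
    have h2 : qInteger q (m * n + m) = qInteger q (m * n) + q ^ (m * n) * qInteger q m := by
      simp [qInteger, sum_range_add, mul_sum, pow_add]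
    rw [h1, mul_add, mul_one, h2, ih, ← pow_mul]
    ring

/-- The two sides of the congruence agree when `a` is `q ^ (-(2 j + 1) n)`. -/
theorem deformedSum_inv_pow_eq {K : Type*} [Field K] {q : K} (hq : q ≠ 0)
    (h1 : ∀ i : ℕ, q ^ (i + 1) ≠ 1) (h j M M' : ℕ) (hM : j * (2 * h + 1) + h ≤ M) (hM' : j ≤ M') :
    deformedSum (q ^ ((2 * j + 1) * (2 * h + 1)))⁻¹ q M = ((-q) ^ h)⁻¹ * qInteger q (2 * h + 1) *
      deformedSum (q ^ ((2 * j + 1) * (2 * h + 1)))⁻¹ (q ^ (2 * h + 1)) M' := by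
  have e1 := deformedSum_inv_pow hq h1 M _ hM
  have e2 := deformedSum_inv_pow (pow_ne_zero (2 * h + 1) hq)
    (fun i hi => h1 ((2 * h + 1) * i + 2 * h) (by rw [← hi]; ring)) M' j hM'
  -- With n = 2h+1, the number (2j+1)n is 2J+1 for J = jn + h. Oddness of n turns (-q)^(nj) into
  -- (-q^n)^j.
  rw [show 2 * (j * (2 * h + 1) + h) + 1 = (2 * h + 1) * (2 * j + 1) by ring, qInteger_mul, ← e2,
    pow_add, mul_comm j, pow_mul, Odd.neg_pow ⟨h, rfl⟩, ← pow_mul q, mul_comm (2 * h + 1)] at e1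
  have n1 : (-q) ^ h ≠ 0 := pow_ne_zero _ (neg_ne_zero.mpr hq)
  have n2 : (-q ^ (2 * h + 1)) ^ j ≠ 0 := pow_ne_zero _ (neg_ne_zero.mpr (pow_ne_zero _ hq))
  apply mul_left_cancel₀ (mul_ne_zero n2 n1)
  rw [e1]
  field_simp

/-- The difference of the two sides of the congruence, with `n = 2 h + 1`. -/
noncomputable def sideDiff (h M M' : ℕ) : RatQA :=
  deformedSum ratA ratQ M -
    ((-ratQ) ^ h)⁻¹ * qInteger ratQ (2 * h + 1) * deformedSum ratA (ratQ ^ (2 * h + 1)) M'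

variable {L : Type*} [Field L] {z x : L}

theorem specializesTo_ratQ (z x : L) : SpecializesTo (evalQA z x) ratQ z := by
  simpa [ratQ] using SpecializesTo.of_algebraMap (K := RatQA) (evalQA z x) polyQ

theorem specializesTo_ratA (z x : L) : SpecializesTo (evalQA z x) ratA x := by
  simpa [ratA] using SpecializesTo.of_algebraMap (K := RatQA) (evalQA z x) polyA

theorem specializesTo_sideDiff_of_pow (hz : z ≠ 0) (h1 : ∀ i : ℕ, z ^ (i + 1) ≠ 1)
    (h j M M' : ℕ) (hM : j * (2 * h + 1) + h ≤ M) (hM' : j ≤ M')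
    (hx : x = z ^ ((2 * j + 1) * (2 * h + 1)) ∨ x = (z ^ ((2 * j + 1) * (2 * h + 1)))⁻¹) :
    SpecializesTo (evalQA z x) (sideDiff h M M') 0 := by
  have hQ := specializesTo_ratQ z x
  have hA := specializesTo_ratA z x
  have hx0 : x ≠ 0 := by
    rcases hx with rfl | rfl
    · exact pow_ne_zero _ hz
    · exact inv_ne_zero (pow_ne_zero _ hz)
  have hinj : ∀ k l : ℕ, z ^ k = z ^ l → k = l := by
    have : ∀ k l : ℕ, k < l → z ^ k ≠ z ^ l := fun k l hkl he => by
      obtain ⟨c, rfl⟩ := Nat.exists_eq_add_of_lt hkl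
      refine h1 c (mul_left_cancel₀ (pow_ne_zero k hz) ?_)
      rw [← pow_add, ← add_assoc, ← he, mul_one]
    intro k l he
    rcases lt_trichotomy k l with hlt | heq | hlt
    · exact absurd he (this k l hlt)
    · exact heq
    · exact absurd he.symm (this l k hlt)
  -- The poles in a lie at even powers of z and their inverses, whereas x is an odd power or the
  -- inverse of one.
  have hne1 : ∀ c l : ℕ, l = c * 2 → x ≠ z ^ l := by
    rintro c l rfl he
    rcases hx with rfl | rfl
    · have hodd : Odd ((2 * j + 1) * (2 * h + 1)) := Odd.mul ⟨j, rfl⟩ ⟨h, rfl⟩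
      obtain ⟨t, ht⟩ := hodd
      have := hinj _ _ he
      omega
    · rw [inv_eq_iff_eq_inv, ← mul_eq_one_iff_eq_inv₀ (pow_ne_zero _ hz), ← pow_add] at he
      have := hinj _ 0 (by rw [he, pow_zero])
      have hpos : 0 < (2 * j + 1) * (2 * h + 1) := by positivity
      omega
  have hne2 : ∀ c l : ℕ, l = c * 2 → x * z ^ l ≠ 1 := by
    rintro c l rfl he
    rcases hx with rfl | rfl
    · rw [← pow_add] at he
      have := hinj _ 0 (by rw [he, pow_zero])
      have hpos : 0 < (2 * j + 1) * (2 * h + 1) := by positivity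
      omega
    · have hodd : Odd ((2 * j + 1) * (2 * h + 1)) := Odd.mul ⟨j, rfl⟩ ⟨h, rfl⟩
      obtain ⟨t, ht⟩ := hodd
      rw [inv_mul_eq_one₀ (pow_ne_zero _ hz)] at he
      have := hinj _ _ he
      omega
  have key : deformedSum x z M = ((-z) ^ h)⁻¹ * qInteger z (2 * h + 1) *
      deformedSum x (z ^ (2 * h + 1)) M' := by
    rcases hx with rfl | rfl
    · rw [← deformedSum_swap, deformedSum_inv_pow_eq hz h1 h j M M' hM hM', deformedSum_swap]
    · exact deformedSum_inv_pow_eq hz h1 h j M M' hM hM'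
  rw [← sub_eq_zero.mpr key]
  refine (hA.deformedSum hQ hx0 (fun i => hne1 (2 * i + 2) _ (by ring))
    (fun i => hne2 (2 * i + 2) _ (by ring)) h1 M).sub
    ((((hQ.neg.pow h).inv (pow_ne_zero _ (neg_ne_zero.mpr hz))).mul (hQ.qInteger _)).mul
      (hA.deformedSum (hQ.pow _) hx0 (fun i => ?_) (fun i => ?_) (fun i => ?_) M'))
  · rw [← pow_mul]
    exact hne1 ((2 * h + 1) * (2 * i + 2)) _ (by ring)
  · rw [← pow_mul]
    exact hne2 ((2 * h + 1) * (2 * i + 2)) _ (by ring)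
  · rw [← pow_mul, show (2 * h + 1) * (i + 1) = (2 * h + 1) * i + 2 * h + 1 by ring]
    exact h1 _

theorem polyQ_pow_ne_one (i : ℕ) : polyQ ^ (i + 1) ≠ 1 := fun h => by
  simpa using congrArg (evalQA (0 : ℤ) 0) h

/-- Specialization of a sum `deformedSum` at a root of unity `q` of odd order. -/
theorem exists_specializesTo_deformedSum [CharZero L] {N : ℕ} (hN : Odd N) (hzN : z ^ N = 1)
    (hx : x ≠ 0) (h1 : ∀ i : ℕ, x ≠ z ^ i) (h2 : ∀ i : ℕ, x * z ^ i ≠ 1) (e : ℕ) (he : 0 < e) :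
    ∃ g : ℕ → L, g 0 = 1 ∧ (∀ k, (1 - (z ^ e) ^ (4 * k + 4)) * g (k + 1) =
        (1 - (z ^ e) ^ (4 * k + 2)) * g k) ∧
      ∀ M, SpecializesTo (evalQA z x) (deformedSum ratA (ratQ ^ e) M)
        (∑ k ∈ range (M + 1), deformedCoeff x (z ^ e) k * g k) := by
  have hQ := (specializesTo_ratQ z x).pow e
  have hA := specializesTo_ratA z x
  have hinj := IsFractionRing.injective PolyQA RatQA
  have hroot : ∀ i : ℕ, (polyQ ^ e) ^ (i + 1) ≠ 1 := fun i => by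
    obtain ⟨e, rfl⟩ := Nat.exists_eq_add_of_lt he
    rw [← pow_mul, show (0 + e + 1) * (i + 1) = (e * i + e + i) + 1 by ring]
    exact polyQ_pow_ne_one _
  have hcent : ∀ k, ∃ y, SpecializesTo (evalQA z x) (centralCoeff (ratQ ^ e : RatQA) k) y := by
    intro k
    have := exists_specializesTo_centralCoeff (K := RatQA) (φ := evalQA z x) hroot
      (fun i hi => ?_) k
    · simpa [ratQ] using this
    · rw [map_pow, evalQA_polyQ, ← pow_mul] at hi
      -- A power of z equal to -1 would, raised to the odd N, give 1 = -1, which characteristic zero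
      -- excludes.
      have := congrArg (· ^ N) hi
      simp only [hN.neg_pow, one_pow, ← pow_mul, mul_comm _ N] at this
      rw [pow_mul, hzN, one_pow] at this
      norm_num at this
  choose g hg using hcent
  refine ⟨g, (hg 0).unique ?_, fun k => ?_, fun M => ?_⟩
  · simpa [centralCoeff] using SpecializesTo.one (K := RatQA) (evalQA z x)
  · have s1 := ((SpecializesTo.one (evalQA z x)).sub (hQ.pow (4 * k + 4))).mul (hg (k + 1))
    have s2 := ((SpecializesTo.one (evalQA z x)).sub (hQ.pow (4 * k + 2))).mul (hg k)
    refine s1.unique ?_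
    convert s2 using 1
    have hne : (1 : RatQA) - (ratQ ^ e) ^ (4 * k + 4) ≠ 0 := by
      refine sub_ne_zero.mpr fun h => hroot (4 * k + 3) (hinj ?_)
      simpa [ratQ] using h.symm
    rw [centralCoeff, centralCoeff, qShifted_succ, qShifted_succ, ← div_mul_div_comm,
      show (ratQ ^ e : RatQA) ^ (4 * k + 4) = (ratQ ^ e) ^ 4 * ((ratQ ^ e) ^ 4) ^ k by ring,
      show (ratQ ^ e : RatQA) ^ (4 * k + 2) = (ratQ ^ e) ^ 2 * ((ratQ ^ e) ^ 4) ^ k by ring]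
    rw [show (ratQ ^ e : RatQA) ^ (4 * k + 4) = (ratQ ^ e) ^ 4 * ((ratQ ^ e) ^ 4) ^ k by ring]
      at hne
    rw [mul_left_comm, mul_div_cancel₀ _ hne, mul_comm]
  · rw [deformedSum_eq_sum]
    refine SpecializesTo.sum fun k _ => (hA.deformedCoeff hQ hx (fun i => ?_) (fun i => ?_) k).mul
      (hg k)
    · rw [← pow_mul]
      exact h1 _
    · rw [← pow_mul]
      exact h2 _

theorem specializesTo_sideDiff_of_root [CharZero L] {h r d : ℕ} (hr : 1 ≤ r)
    (hd : d = 1 ∨ d = 2) (hzN : z ^ (2 * h + 1) ^ r = 1) (hz1 : z ≠ 1)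
    (hx : x ≠ 0) (h1 : ∀ i : ℕ, x ≠ z ^ i) (h2 : ∀ i : ℕ, x * z ^ i ≠ 1) :
    SpecializesTo (evalQA z x)
      (sideDiff h (((2 * h + 1) ^ r - 1) / d) (((2 * h + 1) ^ (r - 1) - 1) / d)) 0 := by
  have hodd : ∀ s, Odd ((2 * h + 1) ^ s) := fun s => Odd.pow ⟨h, rfl⟩
  have hz : z ≠ 0 := fun h0 => by
    rw [h0, zero_pow (hodd r).pos.ne'] at hzN
    exact zero_ne_one hzN
  have hQ := specializesTo_ratQ z x
  obtain ⟨g, g0, hg, hS⟩ := exists_specializesTo_deformedSum (hodd r) hzN hx h1 h2 1 one_pos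
  obtain ⟨g', g0', hg', hS'⟩ := exists_specializesTo_deformedSum (hodd r) hzN hx h1 h2
    (2 * h + 1) (by omega)
  simp only [pow_one] at hg hS
  have hleft := hS (((2 * h + 1) ^ r - 1) / d)
  rw [sum_deformedCoeff_mul_eq_zero (hodd r) hzN hz1 hd hx h1 h2 g0 hg] at hleft
  have hright := (((hQ.neg.pow h).inv (pow_ne_zero _ (neg_ne_zero.mpr hz))).mul
    (hQ.qInteger (2 * h + 1))).mul (hS' (((2 * h + 1) ^ (r - 1) - 1) / d))
  have hzero : ((-z) ^ h)⁻¹ * qInteger z (2 * h + 1) *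
      ∑ k ∈ range (((2 * h + 1) ^ (r - 1) - 1) / d + 1),
        deformedCoeff x (z ^ (2 * h + 1)) k * g' k = 0 := by
    -- If z^n = 1 the factor [n] vanishes, and the sum only has to be regular. Otherwise z^n is a
    -- nontrivial root of unity of order dividing n^(r-1).
    by_cases hw : z ^ (2 * h + 1) = 1
    · have h0 : qInteger z (2 * h + 1) = 0 := by
        apply mul_right_cancel₀ (sub_ne_zero.mpr hz1.symm)
        rw [qInteger_mul_one_sub, hw, sub_self, zero_mul]
      rw [h0, mul_zero, zero_mul]
    · rw [sum_deformedCoeff_mul_eq_zero (hodd (r - 1)) ?_ hw hd hx (fun i => ?_) (fun i => ?_)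
        g0' hg', mul_zero]
      · rw [← pow_mul, ← pow_succ', Nat.sub_add_cancel hr, hzN]
      · rw [← pow_mul]
        exact h1 _
      · rw [← pow_mul]
        exact h2 _
  rw [hzero] at hright
  simpa [sideDiff] using hleft.sub hright

theorem qInteger_polyQ (N : ℕ) (hN : 0 < N) :
    qInteger polyQ N = ∏ m ∈ N.divisors.erase 1, (C (cyclotomic m ℤ) : PolyQA) := by
  rw [← map_prod, prod_cyclotomic_eq_geom_sum hN]
  simp [qInteger, polyQ]

end Main

theorem mainTheorem4 (n r d : ℕ) (hn : 1 < n) (hodd : Odd n) (hr : 1 ≤ r) (hd : d = 1 ∨ d = 2) :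
    RatCongr
      (qInteger polyQ (n ^ r) *
        ∏ j ∈ Finset.range ((n ^ (r - 1) - 1) / d + 1),
          ((1 - polyA * polyQ ^ ((2 * j + 1) * n)) * (polyA - polyQ ^ ((2 * j + 1) * n))))
      (deformedSum ratA ratQ ((n ^ r - 1) / d))
      ((-ratQ) ^ ((1 - (n : ℤ)) / 2) * qInteger ratQ n *
        deformedSum ratA (ratQ ^ n) ((n ^ (r - 1) - 1) / d)) := by
  obtain ⟨h, rfl⟩ := hodd
  have hpos : 0 < (2 * h + 1) ^ r := by positivity
  have hpos' : 0 < (2 * h + 1) ^ (r - 1) := by positivity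
  rw [neg_pow_zpow, qInteger_polyQ _ hpos]
  have hinjC := IsFractionRing.injective ℂ[X] (FractionRing ℂ[X])
  have hinjZ := IsFractionRing.injective ℤ[X] (FractionRing ℤ[X])
  set q : FractionRing ℤ[X] := algebraMap ℤ[X] (FractionRing ℤ[X]) X with hq
  have hq0 : q ≠ 0 := (map_ne_zero_iff _ hinjZ).mpr X_ne_zero
  have hq1 : ∀ i : ℕ, q ^ (i + 1) ≠ 1 := fun i hi => by
    have := congrArg natDegree (hinjZ (by rwa [map_pow, map_one]) :
      (X ^ (i + 1) : ℤ[X]) = 1)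
    simp at this
  have hqinj : ∀ k l : ℕ, q ^ k = q ^ l → k = l := fun k l hkl => by
    rw [hq, ← map_pow, ← map_pow] at hkl
    simpa using congrArg natDegree (hinjZ hkl)
  have hA1 : ∀ N N' : ℕ, N ≠ N' → evalQA q (q ^ N)⁻¹ (1 - polyA * polyQ ^ N') ≠ 0 := by
    intro N N' hN
    simp only [map_mul, map_sub, map_one, map_pow, evalQA_polyA, evalQA_polyQ]
    refine sub_ne_zero.mpr fun he => hN (hqinj _ _ ?_)
    exact (inv_mul_eq_one₀ (pow_ne_zero _ hq0)).mp he.symm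
  have hA2 : ∀ N N' : ℕ, 0 < N → evalQA q (q ^ N)⁻¹ (polyA - polyQ ^ N') ≠ 0 := by
    intro N N' hN
    simp only [map_sub, map_pow, evalQA_polyA, evalQA_polyQ]
    refine sub_ne_zero.mpr fun he => ?_
    have := hqinj (N' + N) 0 (by
      rw [pow_add, ← he, inv_mul_cancel₀ (pow_ne_zero _ hq0), pow_zero])
    omega
  have hB1 : ∀ N N' : ℕ, 0 < N → evalQA q (q ^ N) (1 - polyA * polyQ ^ N') ≠ 0 := by
    intro N N' hN
    simp only [map_mul, map_sub, map_one, map_pow, evalQA_polyA, evalQA_polyQ]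
    refine sub_ne_zero.mpr fun he => ?_
    have := hqinj (N + N') 0 (by rw [pow_add, ← he, pow_zero])
    omega
  have hB2 : ∀ N N' : ℕ, N ≠ N' → evalQA q (q ^ N) (polyA - polyQ ^ N') ≠ 0 := by
    intro N N' hN
    simp only [map_sub, map_pow, evalQA_polyA, evalQA_polyQ]
    exact sub_ne_zero.mpr fun he => hN (hqinj _ _ he)
  -- Both closed forms need their index within the summation range: j on the right and jn + h on the
  -- left.
  have hbound : ∀ j ∈ range (((2 * h + 1) ^ (r - 1) - 1) / d + 1),
      j ≤ ((2 * h + 1) ^ (r - 1) - 1) / d ∧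
        j * (2 * h + 1) + h ≤ ((2 * h + 1) ^ r - 1) / d := by
    intro j hj
    have hj' := Nat.lt_succ_iff.mp (mem_range.mp hj)
    refine ⟨hj', ?_⟩
    have hpow : (2 * h + 1) ^ r = (2 * h + 1) ^ (r - 1) * (2 * h + 1) := by
      rw [← pow_succ, Nat.sub_add_cancel hr]
    rcases hd with rfl | rfl
    · rw [Nat.div_one] at hj' ⊢
      have := Nat.mul_le_mul_right (2 * h + 1) (show j + 1 ≤ (2 * h + 1) ^ (r - 1) by omega)
      rw [← hpow] at this
      have e : (j + 1) * (2 * h + 1) = j * (2 * h + 1) + (2 * h + 1) := by ring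
      omega
    · have := Nat.mul_le_mul_right (2 * h + 1)
        (show 2 * j + 1 ≤ (2 * h + 1) ^ (r - 1) by omega)
      rw [← hpow] at this
      have e : (2 * j + 1) * (2 * h + 1) = 2 * (j * (2 * h + 1)) + (2 * h + 1) := by ring
      omega
  have hNinj : ∀ i j : ℕ, (2 * i + 1) * (2 * h + 1) = (2 * j + 1) * (2 * h + 1) → i = j :=
    fun i j hij => by
      have := Nat.eq_of_mul_eq_mul_right (by omega) hij
      omega
  have hroot : ∀ m ∈ ((2 * h + 1) ^ r).divisors.erase 1, ∃ ζ : ℂ, IsPrimitiveRoot ζ m ∧ 0 < m ∧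
      m ≠ 1 ∧ ζ ^ (2 * h + 1) ^ r = 1 := by
    intro m hm
    obtain ⟨hm1, hm⟩ := mem_erase.mp hm
    have hdvd := Nat.dvd_of_mem_divisors hm
    have hm0 := Nat.pos_of_mem_divisors hm
    have hζ := Complex.isPrimitiveRoot_exp m hm0.ne'
    exact ⟨_, hζ, hm0, hm1, (hζ.pow_eq_one_iff_dvd _).mpr hdvd⟩
  have hXC : ∀ (ζ : ℂ) (i : ℕ), algebraMap ℂ[X] (FractionRing ℂ[X]) X ≠
      algebraMap ℂ[X] (FractionRing ℂ[X]) (C ζ) ^ i := fun ζ i hi => by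
    rw [← map_pow, ← C_pow] at hi
    exact X_ne_C _ (hinjC hi)
  have hXC' : ∀ (ζ : ℂ) (i : ℕ), algebraMap ℂ[X] (FractionRing ℂ[X]) X *
      algebraMap ℂ[X] (FractionRing ℂ[X]) (C ζ) ^ i ≠ 1 := fun ζ i hi => by
    rw [← map_pow, ← map_mul, ← map_one (algebraMap ℂ[X] (FractionRing ℂ[X])), ← C_pow] at hi
    have := congrArg (eval 0) (hinjC hi)
    simp at this
  refine RatCongr.mul (RatCongr.prod (fun m hm => ?_) fun m hm m' hm' hne => ?_)
    (RatCongr.prod (fun j hj => ?_) fun i hi j hj hne => ?_) ?_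
  · obtain ⟨ζ, hζ, hm0, hm1, hζN⟩ := hroot m hm
    refine (isKernelGenerator_cyclotomic hm0 hζ).ratCongr
      (specializesTo_sideDiff_of_root hr hd ?_ ?_ ?_ (hXC ζ) (hXC' ζ))
    · rw [← map_pow, ← C_pow, hζN, C_1, map_one]
    · rw [← map_one (algebraMap ℂ[X] (FractionRing ℂ[X])), ← C_1]
      exact fun h => hm1 (hζ.eq_orderOf.trans (orderOf_eq_one_iff.mpr (C_injective (hinjC h))))
    · exact (map_ne_zero_iff _ hinjC).mpr X_ne_zero
  · obtain ⟨ζ, hζ, hm0, hm1, hζN⟩ := hroot m hm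
    refine (isKernelGenerator_cyclotomic hm0 hζ).isRelPrime fun h0 => ?_
    obtain ⟨ζ', hζ', hm0', -, -⟩ := hroot m' hm'
    have hdvd := (isKernelGenerator_cyclotomic hm0 hζ).dvd _ h0
    have hdvd' := (C_dvd_iff_dvd_coeff _ _).mp hdvd 0
    rw [coeff_C_zero] at hdvd'
    refine hne (cyclotomic_injective (R := ℤ) (eq_of_monic_of_associated
      (cyclotomic.monic m ℤ) (cyclotomic.monic m' ℤ) ?_))
    exact ((cyclotomic.irreducible hm0).dvd_irreducible_iff_associated
      (cyclotomic.irreducible hm0')).mp hdvd'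
  · obtain ⟨hj1, hj2⟩ := hbound j hj
    refine RatCongr.mul ((isKernelGenerator_one_sub _).ratCongr
      (specializesTo_sideDiff_of_pow hq0 hq1 h j _ _ hj2 hj1 (Or.inr rfl)))
      ((isKernelGenerator_sub _).ratCongr
      (specializesTo_sideDiff_of_pow hq0 hq1 h j _ _ hj2 hj1 (Or.inl rfl)))
      ((isKernelGenerator_one_sub _).isRelPrime (hA2 _ _ (by positivity)))
  · have hij : (2 * i + 1) * (2 * h + 1) ≠ (2 * j + 1) * (2 * h + 1) :=
      fun he => hne (hNinj i j he)
    exact IsRelPrime.mul_left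
      (((isKernelGenerator_one_sub _).isRelPrime (hA1 _ _ hij)).mul_right
        ((isKernelGenerator_one_sub _).isRelPrime (hA2 _ _ (by positivity))))
      (((isKernelGenerator_sub _).isRelPrime (hB1 _ _ (by positivity))).mul_right
        ((isKernelGenerator_sub _).isRelPrime (hB2 _ _ hij)))
  -- At q = ζ the indeterminate a stays transcendental over ℂ, so no factor 1 - a q^N or a - q^N
  -- vanishes.
  · refine IsRelPrime.prod_left fun m hm => IsRelPrime.prod_right fun j _ => ?_
    obtain ⟨ζ, hζ, hm0, -, -⟩ := hroot m hm
    refine (isKernelGenerator_cyclotomic hm0 hζ).isRelPrime ?_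
    simp only [map_mul, map_sub, map_one, map_pow, evalQA_polyA, evalQA_polyQ]
    exact mul_ne_zero (sub_ne_zero.mpr (hXC' ζ _).symm) (sub_ne_zero.mpr (hXC ζ _))
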